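/- Let $X=C_{10}(4)$ be the graph with vertex set $\mathbb Z/10$ in which $x$ and $y$ are joined by an edge if and only if $x-y\in\{\pm1,\pm4\}$, and let $d$ be its adjacency matrix. A magic unitary over a unital $C^*$-algebra is a square matrix whose entries are projections and such that every row and every column consists of pairwise orthogonal projections with sum $1$. Let $A(X)$ be the universal unital $C^*$-algebra generated by the entries of a magic unitary $W=(W_{xy})_{x,y\in\mathbb Z/10}$ subject to $dW=Wd$ (the algebra of the quantum automorphism group of $X$). For a finite group $G$ acting on a finite set $Y$, let $C(G)$ be the algebra of complex functions on $G$, with the magic unitary $p_{ij}=\chi\{\sigma\in G\mid\sigma(j)=i\}$ ($i,j\in Y$). Let $u$ be this magic unitary for $\mathbb Z_2$ acting on itself by translation, and $v$ the one for the dihedral group $D_5$ of order $10$ acting on the set $\mathbb Z/5$ of vertices of the pentagon. Let $C(\mathbb Z_2)*_wC(D_5)$ be the free wreath product of $(C(\mathbb Z_2),u)$ and $(C(D_5),v)$: the universal unital $C^*$-algebra generated by copies $C(\mathbb Z_2)^{(a)}$, $a\in\mathbb Z/5$, of $C(\mathbb Z_2)$ and a copy of $C(D_5)$, subject to $u^{(a)}_{ij}v_{ab}=v_{ab}u^{(a)}_{ij}$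 for all $i,j\in\mathbb Z/2$, $a,b\in\mathbb Z/5$. Put $w_{ia,jb}=u^{(a)}_{ij}v_{ab}$. Then $A(X)$ has a unique Hopf $C^*$-algebra structure $(\Delta,\varepsilon,S)$ with $\Delta(W_{xy})=\sum_zW_{xz}\otimes W_{zy}$, $\varepsilon(W_{xy})=\delta_{xy}$, $S(W_{xy})=W_{yx}$; likewise $w$ is a magic unitary and $C(\mathbb Z_2)*_wC(D_5)$ has a unique Hopf $C^*$-algebra structure with the corresponding formulas for $w$ (tensor products being maximal $C^*$-tensor products). With these structures, $$A(C_{10}(4))\;\cong\;C(\mathbb Z_2)*_wC(D_5)$$ as Hopf $C^*$-algebras. More precisely, there are a bijection $e:\mathbb Z/2\times\mathbb Z/5\to\mathbb Z/10$ and an isomorphism of Hopf $C^*$-algebras $\Phi:A(C_{10}(4))\to C(\mathbb Z_2)*_wC(D_5)$ with $\Phi(W_{e(i,a),e(j,b)})=w_{ia,jb}$ for all $i,j,a,b$. -/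

import Mathlib

noncomputable section

/-! ## The free unital complex `*`-algebra -/

/-- The free unital complex `*`-algebra on a set `I`: noncommutative polynomials in letters
`x i` (`Sum.inl i`) and their formal adjoints `x i ^*` (`Sum.inr i`). -/
def FreeStarAlgebra (I : Type*) : Type _ := FreeAlgebra ℂ (I ⊕ I)

namespace FreeStarAlgebra

variable {I : Type*}

instance : Ring (FreeStarAlgebra I) := inferInstanceAs (Ring (FreeAlgebra ℂ (I ⊕ I)))

instance : Algebra ℂ (FreeStarAlgebra I) := inferInstanceAs (Algebra ℂ (FreeAlgebra ℂ (I ⊕ I)))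

/-- The generator attached to `i`. -/
def gen (i : I) : FreeStarAlgebra I := FreeAlgebra.ι ℂ (Sum.inl i)

/-- The formal adjoint of the generator attached to `i`. -/
def genStar (i : I) : FreeStarAlgebra I := FreeAlgebra.ι ℂ (Sum.inr i)

theorem induction {motive : FreeStarAlgebra I → Prop}
    (algebraMap : ∀ r : ℂ, motive (algebraMap ℂ (FreeStarAlgebra I) r))
    (gen : ∀ i, motive (gen i)) (genStar : ∀ i, motive (genStar i))
    (mul : ∀ a b, motive a → motive b → motive (a * b))
    (add : ∀ a b, motive a → motive b → motive (a + b)) (a : FreeStarAlgebra I) : motive a :=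
  FreeAlgebra.induction (R := ℂ) (X := I ⊕ I) (motive := motive)
    algebraMap (fun x => Sum.casesOn x gen genStar) mul add a

/-- The opposite algebra, with scalars acting through complex conjugation. -/
def ConjOp (I : Type*) : Type _ := (FreeStarAlgebra I)ᵐᵒᵖ

instance : Ring (ConjOp I) := inferInstanceAs (Ring (FreeStarAlgebra I)ᵐᵒᵖ)

instance : Algebra ℂ (ConjOp I) :=
  RingHom.toAlgebra'
    ((algebraMap ℂ (FreeStarAlgebra I)ᵐᵒᵖ).comp (starRingEnd ℂ))
    (fun c x => Algebra.commutes (A := (FreeStarAlgebra I)ᵐᵒᵖ) (starRingEnd ℂ c) x)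

/-- The conjugate-linear antiautomorphism exchanging `x i` and `x i ^*`, as a homomorphism. -/
def starHom (I : Type*) : FreeStarAlgebra I →ₐ[ℂ] ConjOp I :=
  FreeAlgebra.lift ℂ (X := I ⊕ I) (A := ConjOp I)
    (fun x => (MulOpposite.op (FreeAlgebra.ι ℂ x.swap : FreeStarAlgebra I) :
      (FreeStarAlgebra I)ᵐᵒᵖ))

/-- The underlying element of an element of the conjugate-opposite algebra. -/
def ofConjOp (x : ConjOp I) : FreeStarAlgebra I := MulOpposite.unop (x : (FreeStarAlgebra I)ᵐᵒᵖ)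

instance : Star (FreeStarAlgebra I) := ⟨fun a => ofConjOp (starHom I a)⟩

theorem star_def (a : FreeStarAlgebra I) : star a = ofConjOp (starHom I a) := rfl

@[simp] theorem star_gen (i : I) : star (gen i) = genStar i := by
  have h := FreeAlgebra.lift_ι_apply (R := ℂ) (A := ConjOp I)
    (fun x : I ⊕ I => (MulOpposite.op (FreeAlgebra.ι ℂ x.swap : FreeStarAlgebra I) :
      (FreeStarAlgebra I)ᵐᵒᵖ)) (Sum.inl i)
  exact congrArg ofConjOp h

@[simp] theorem star_genStar (i : I) : star (genStar i) = gen i := by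
  have h := FreeAlgebra.lift_ι_apply (R := ℂ) (A := ConjOp I)
    (fun x : I ⊕ I => (MulOpposite.op (FreeAlgebra.ι ℂ x.swap : FreeStarAlgebra I) :
      (FreeStarAlgebra I)ᵐᵒᵖ)) (Sum.inr i)
  exact congrArg ofConjOp h

theorem star_add_aux (a b : FreeStarAlgebra I) : star (a + b) = star a + star b :=
  congrArg ofConjOp (map_add (starHom I) a b)

theorem star_mul_aux (a b : FreeStarAlgebra I) : star (a * b) = star b * star a :=
  congrArg ofConjOp (map_mul (starHom I) a b)

theorem star_algebraMap_aux (r : ℂ) :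
    star (algebraMap ℂ (FreeStarAlgebra I) r) = algebraMap ℂ (FreeStarAlgebra I) (star r) :=
  congrArg ofConjOp ((starHom I).commutes r)

instance : StarRing (FreeStarAlgebra I) where
  star_involutive a := by
    induction a using FreeStarAlgebra.induction with
    | algebraMap r => rw [star_algebraMap_aux, star_algebraMap_aux, star_star]
    | gen i => rw [star_gen, star_genStar]
    | genStar i => rw [star_genStar, star_gen]
    | mul a b ha hb => rw [star_mul_aux, star_mul_aux, ha, hb]
    | add a b ha hb => rw [star_add_aux, star_add_aux, ha, hb]
  star_mul := star_mul_aux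
  star_add := star_add_aux

instance : StarModule ℂ (FreeStarAlgebra I) where
  star_smul r a := by
    rw [Algebra.smul_def, star_mul, star_algebraMap_aux, Algebra.smul_def, Algebra.commutes]

section lift

variable {B : Type*} [Ring B] [StarRing B] [Algebra ℂ B]

/-- Evaluation of a noncommutative `*`-polynomial at a family of elements of a `*`-algebra. -/
def liftAlgHom (f : I → B) : FreeStarAlgebra I →ₐ[ℂ] B :=
  FreeAlgebra.lift ℂ (X := I ⊕ I) (Sum.elim f fun i => star (f i))

theorem liftAlgHom_gen (f : I → B) (i : I) : liftAlgHom f (gen i) = f i :=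
  FreeAlgebra.lift_ι_apply (X := I ⊕ I) (Sum.elim f fun i => star (f i)) (Sum.inl i)

theorem liftAlgHom_genStar (f : I → B) (i : I) : liftAlgHom f (genStar i) = star (f i) :=
  FreeAlgebra.lift_ι_apply (X := I ⊕ I) (Sum.elim f fun i => star (f i)) (Sum.inr i)

variable [StarModule ℂ B]

/-- Evaluation of a noncommutative `*`-polynomial, as a `*`-homomorphism. -/
def lift (f : I → B) : FreeStarAlgebra I →⋆ₐ[ℂ] B :=
  { liftAlgHom f with
    map_star' := fun a => by
      change liftAlgHom f (star a) = star (liftAlgHom f a)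
      induction a using FreeStarAlgebra.induction with
      | algebraMap r =>
        rw [star_algebraMap_aux, AlgHom.commutes, AlgHom.commutes, algebraMap_star_comm]
      | gen i => rw [star_gen, liftAlgHom_gen, liftAlgHom_genStar]
      | genStar i => rw [star_genStar, liftAlgHom_gen, liftAlgHom_genStar, star_star]
      | mul a b ha hb => rw [star_mul, map_mul, map_mul, ha, hb, star_mul]
      | add a b ha hb => rw [star_add, map_add, map_add, ha, hb, star_add] }

@[simp] theorem lift_gen (f : I → B) (i : I) : lift f (gen i) = f i := liftAlgHom_gen f i

@[simp] theorem lift_genStar (f : I → B) (i : I) : lift f (genStar i) = star (f i) :=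
  liftAlgHom_genStar f i

end lift

end FreeStarAlgebra

/-! ## `C*`-seminorms and their completions -/

/-- A `C*`-seminorm on a unital complex `*`-algebra. -/
structure CStarSeminorm (𝒜 : Type*) [Ring 𝒜] [StarRing 𝒜] [Algebra ℂ 𝒜] extends
    RingSeminorm 𝒜 where
  smul' : ∀ (c : ℂ) (a : 𝒜), toFun (c • a) = ‖c‖ * toFun a
  star_mul_self' : ∀ a : 𝒜, toFun (star a * a) = toFun a * toFun a

namespace CStarSeminorm

variable {𝒜 : Type*} [Ring 𝒜] [StarRing 𝒜] [Algebra ℂ 𝒜]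

instance : FunLike (CStarSeminorm 𝒜) 𝒜 ℝ where
  coe N := N.toFun
  coe_injective N N' h := by
    obtain ⟨N, _, _⟩ := N
    obtain ⟨N', _, _⟩ := N'
    have hN : N = N' := DFunLike.coe_injective h
    subst hN
    rfl

instance : RingSeminormClass (CStarSeminorm 𝒜) 𝒜 ℝ where
  map_add_le_add N := N.add_le'
  map_mul_le_mul N := N.mul_le'
  map_neg_eq_map N := N.neg'
  map_zero N := N.map_zero'

theorem smul (N : CStarSeminorm 𝒜) (c : ℂ) (a : 𝒜) : N (c • a) = ‖c‖ * N a := N.smul' c a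

theorem star_mul_self (N : CStarSeminorm 𝒜) (a : 𝒜) : N (star a * a) = N a * N a :=
  N.star_mul_self' a

theorem le_star (N : CStarSeminorm 𝒜) (a : 𝒜) : N a ≤ N (star a) := by
  have h : N a * N a ≤ N (star a) * N a := by
    rw [← N.star_mul_self]; exact map_mul_le_mul N _ _
  rcases (apply_nonneg N a).eq_or_lt with h0 | h0
  · rw [← h0]; exact apply_nonneg N _
  · exact le_of_mul_le_mul_right h h0

theorem star_eq (N : CStarSeminorm 𝒜) (a : 𝒜) : N (star a) = N a :=
  le_antisymm (by simpa using N.le_star (star a)) (N.le_star a)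

/-- The algebra `𝒜`, carrying the topology of the seminorm `N`. -/
def Carrier (_N : CStarSeminorm 𝒜) : Type _ := 𝒜

variable (N : CStarSeminorm 𝒜)

instance : SeminormedRing N.Carrier := N.toRingSeminorm.toSeminormedRing

instance : StarRing N.Carrier := inferInstanceAs (StarRing 𝒜)

instance : NormedAlgebra ℂ N.Carrier :=
  { (inferInstanceAs (Algebra ℂ 𝒜) : Algebra ℂ N.Carrier) with
    norm_smul_le := fun c a => (N.smul c a).le }

instance : NormedStarGroup N.Carrier where
  norm_star_le a := (N.star_eq a).le

instance [StarModule ℂ 𝒜] : StarModule ℂ N.Carrier := inferInstanceAs (StarModule ℂ 𝒜)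

/-- The `C*`-algebra obtained from `𝒜` by separation and completion with respect to the
`C*`-seminorm `N`. -/
def Envelope : Type _ := UniformSpace.Completion N.Carrier

namespace Envelope

instance : NormedRing N.Envelope := inferInstanceAs (NormedRing (UniformSpace.Completion N.Carrier))

instance : CompleteSpace N.Envelope := inferInstanceAs (CompleteSpace (UniformSpace.Completion N.Carrier))

instance : Algebra ℂ N.Envelope := inferInstanceAs (Algebra ℂ (UniformSpace.Completion N.Carrier))

instance : NormedAlgebra ℂ N.Envelope :=
  { (inferInstance : Algebra ℂ N.Envelope) with
    norm_smul_le := fun c a =>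
      norm_smul_le (α := ℂ) (β := UniformSpace.Completion N.Carrier) c a }

variable {N} in
/-- The image of an element of `𝒜` in the completion. -/
def mk (a : 𝒜) : N.Envelope := ((show N.Carrier from a : N.Carrier) : UniformSpace.Completion N.Carrier)

theorem mk_add (a b : 𝒜) : (mk (a + b) : N.Envelope) = mk a + mk b :=
  UniformSpace.Completion.coe_add (α := N.Carrier) a b

theorem mk_mul (a b : 𝒜) : (mk (a * b) : N.Envelope) = mk a * mk b :=
  UniformSpace.Completion.coe_mul (α := N.Carrier) a b

theorem norm_mk (a : 𝒜) : ‖(mk a : N.Envelope)‖ = N a :=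
  UniformSpace.Completion.norm_coe (E := N.Carrier) a

theorem denseRange_mk : DenseRange (mk : 𝒜 → N.Envelope) :=
  UniformSpace.Completion.denseRange_coe (α := N.Carrier)

theorem uniformContinuous_star : UniformContinuous (star : N.Carrier → N.Carrier) :=
  (AddMonoidHomClass.isometry_of_norm (starAddEquiv : N.Carrier ≃+ N.Carrier)
    (fun a => norm_star a)).uniformContinuous

instance : Star N.Envelope := ⟨UniformSpace.Completion.map (star : N.Carrier → N.Carrier)⟩

theorem continuous_star' : Continuous (star : N.Envelope → N.Envelope) :=
  UniformSpace.Completion.continuous_map (f := (star : N.Carrier → N.Carrier))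

theorem mk_star (a : 𝒜) : (mk (star a) : N.Envelope) = star (mk a) :=
  (UniformSpace.Completion.map_coe (uniformContinuous_star N) (show N.Carrier from a)).symm

instance : StarRing N.Envelope where
  star_involutive a := by
    refine (denseRange_mk N).induction_on a
      (isClosed_eq ((continuous_star' N).comp (continuous_star' N)) continuous_id) fun a => ?_
    rw [← mk_star, ← mk_star, star_star]
  star_mul a b := by
    refine (denseRange_mk N).induction_on₂ (p := fun a b : N.Envelope =>
      star (a * b) = star b * star a) ?_ (fun a b => ?_) a b
    · exact isClosed_eq ((continuous_star' N).comp (continuous_fst.mul continuous_snd))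
        (((continuous_star' N).comp continuous_snd).mul ((continuous_star' N).comp continuous_fst))
    · rw [← mk_mul, ← mk_star, ← mk_star, ← mk_star, ← mk_mul, star_mul]
  star_add a b := by
    refine (denseRange_mk N).induction_on₂ (p := fun a b : N.Envelope =>
      star (a + b) = star a + star b) ?_ (fun a b => ?_) a b
    · exact isClosed_eq ((continuous_star' N).comp (continuous_fst.add continuous_snd))
        (((continuous_star' N).comp continuous_fst).add ((continuous_star' N).comp continuous_snd))
    · rw [← mk_add, ← mk_star, ← mk_star, ← mk_star, ← mk_add, star_add]

theorem mk_smul (c : ℂ) (a : 𝒜) : (mk (c • a) : N.Envelope) = c • mk a :=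
  UniformSpace.Completion.coe_smul (X := N.Carrier) c a

instance : CStarRing N.Envelope where
  norm_mul_self_le a := by
    refine (denseRange_mk N).induction_on (p := fun a : N.Envelope =>
      ‖a‖ * ‖a‖ ≤ ‖star a * a‖) a ?_ fun a => ?_
    · exact isClosed_le (continuous_norm.mul continuous_norm)
        (continuous_norm.comp ((continuous_star' N).mul continuous_id))
    · rw [← mk_star, ← mk_mul, norm_mk, norm_mk, N.star_mul_self]

variable [StarModule ℂ 𝒜]

instance : StarModule ℂ N.Envelope where
  star_smul c a := by
    refine (denseRange_mk N).induction_on (p := fun a : N.Envelope =>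
      star (c • a) = star c • star a) a ?_ fun a => ?_
    · exact isClosed_eq ((continuous_star' N).comp (continuous_const_smul c))
        ((continuous_const_smul (star c)).comp (continuous_star' N))
    · rw [← mk_smul, ← mk_star, ← mk_star, ← mk_smul, star_smul]

instance : CStarAlgebra N.Envelope where

/-- The canonical `*`-homomorphism from `𝒜` to the completion. -/
def mkHom : 𝒜 →⋆ₐ[ℂ] N.Envelope where
  toFun := mk
  map_one' := rfl
  map_mul' := mk_mul N
  map_zero' := rfl
  map_add' := mk_add N
  commutes' _ := rfl
  map_star' := mk_star N

end Envelope

theorem Envelope.mkHom_apply_norm [StarModule ℂ 𝒜] (a : 𝒜) : ‖Envelope.mkHom N a‖ = N a :=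
  Envelope.norm_mk N a

theorem Envelope.denseRange_mkHom [StarModule ℂ 𝒜] : DenseRange (Envelope.mkHom N) :=
  Envelope.denseRange_mk N

/-- The `C*`-seminorm `a ↦ ‖f a‖` of a `*`-homomorphism into a `C*`-algebra. -/
def ofStarAlgHom {B : Type*} [CStarAlgebra B] (f : 𝒜 →⋆ₐ[ℂ] B) : CStarSeminorm 𝒜 where
  toFun a := ‖f a‖
  map_zero' := by simp
  add_le' a b := by rw [map_add]; exact norm_add_le _ _
  neg' a := by rw [map_neg, norm_neg]
  mul_le' a b := by rw [map_mul]; exact norm_mul_le _ _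
  smul' c a := by rw [map_smul, norm_smul]
  star_mul_self' a := by rw [map_mul, map_star, CStarRing.norm_star_mul_self]

/-- A `*`-homomorphism on `𝒜`, seen on the seminormed ring `N.Carrier`. -/
def carrierHom {B : Type*} [CStarAlgebra B] (f : 𝒜 →⋆ₐ[ℂ] B) : N.Carrier →+* B where
  toFun a := f (show 𝒜 from a)
  map_one' := map_one f
  map_mul' := map_mul f
  map_zero' := map_zero f
  map_add' := map_add f

theorem continuous_carrierHom {B : Type*} [CStarAlgebra B] (f : 𝒜 →⋆ₐ[ℂ] B)
    (hf : ∀ a, ‖f a‖ ≤ N a) : Continuous (N.carrierHom f) :=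
  AddMonoidHomClass.continuous_of_bound (N.carrierHom f) 1
    fun a => by rw [one_mul]; exact hf a

/-- Extension to the completion of a `*`-homomorphism that is contractive for the seminorm. -/
def Envelope.lift [StarModule ℂ 𝒜] {B : Type*} [CStarAlgebra B] (f : 𝒜 →⋆ₐ[ℂ] B)
    (hf : ∀ a, ‖f a‖ ≤ N a) : N.Envelope →⋆ₐ[ℂ] B :=
  let F : N.Envelope →+* B :=
    UniformSpace.Completion.extensionHom (N.carrierHom f) (N.continuous_carrierHom f hf)
  have hF : ∀ a : 𝒜, F (mk a) = f a := fun a =>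
    UniformSpace.Completion.extensionHom_coe (N.carrierHom f) (N.continuous_carrierHom f hf) a
  have hcont : Continuous F := UniformSpace.Completion.continuous_extension
  { F with
    commutes' := fun c => (hF (algebraMap ℂ 𝒜 c)).trans (AlgHomClass.commutes f c)
    map_star' := fun a => (denseRange_mk N).induction_on (p := fun a => F (star a) = star (F a)) a
      (isClosed_eq (hcont.comp (continuous_star' N)) (ContinuousStar.continuous_star.comp hcont))
      fun a => by rw [← mk_star, hF, hF, map_star] }

theorem Envelope.lift_mkHom [StarModule ℂ 𝒜] {B : Type*} [CStarAlgebra B] (f : 𝒜 →⋆ₐ[ℂ] B)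
    (hf : ∀ a, ‖f a‖ ≤ N a) (a : 𝒜) : Envelope.lift N f hf (Envelope.mkHom N a) = f a :=
  UniformSpace.Completion.extensionHom_coe (N.carrierHom f) (N.continuous_carrierHom f hf) a

/-- A `C*`-seminorm respects a set of relations `p = q` if all `p - q` have seminorm zero. -/
def Respects (rel : 𝒜 → 𝒜 → Prop) : Prop := ∀ a b, rel a b → N (a - b) = 0

/-- The `C*`-seminorms respecting the relations are bounded at each element. -/
def Bounded (rel : 𝒜 → 𝒜 → Prop) : Prop :=
  ∀ a : 𝒜, ∃ C : ℝ, ∀ N : CStarSeminorm 𝒜, N.Respects rel → N a ≤ C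

/-- The largest `C*`-seminorm respecting the given relations. -/
def maximal (rel : 𝒜 → 𝒜 → Prop) (h : Bounded rel) : CStarSeminorm 𝒜 :=
  have bdd : ∀ a, BddAbove (Set.range fun N : {N : CStarSeminorm 𝒜 // N.Respects rel} => N.1 a) :=
    fun a => by
      obtain ⟨C, hC⟩ := h a
      exact ⟨C, by rintro _ ⟨N, rfl⟩; exact hC N.1 N.2⟩
  have : Nonempty {N : CStarSeminorm 𝒜 // N.Respects rel} :=
    ⟨⟨{ (0 : RingSeminorm 𝒜) with
        smul' := fun c _ => (mul_zero ‖c‖).symm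
        star_mul_self' := fun _ => (mul_zero (0 : ℝ)).symm }, fun _ _ _ => rfl⟩⟩
  have nonneg : ∀ a, 0 ≤ ⨆ N : {N : CStarSeminorm 𝒜 // N.Respects rel}, N.1 a :=
    fun a => Real.iSup_nonneg fun N => apply_nonneg N.1 a
  { toFun := fun a => ⨆ N : {N : CStarSeminorm 𝒜 // N.Respects rel}, N.1 a
    map_zero' := by simp
    add_le' := fun a b => ciSup_le fun N => (map_add_le_add N.1 a b).trans
      (add_le_add (le_ciSup (bdd a) N) (le_ciSup (bdd b) N))
    neg' := fun a => by simp only [map_neg_eq_map]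
    mul_le' := fun a b => ciSup_le fun N => (map_mul_le_mul N.1 a b).trans
      (mul_le_mul (le_ciSup (bdd a) N) (le_ciSup (bdd b) N) (apply_nonneg N.1 b) (nonneg a))
    smul' := fun c a => by
      simp only [CStarSeminorm.smul]
      exact (Real.mul_iSup_of_nonneg (norm_nonneg c) _).symm
    star_mul_self' := fun a => by
      simp only [CStarSeminorm.star_mul_self]
      refine le_antisymm (ciSup_le fun N => mul_le_mul (le_ciSup (bdd a) N)
        (le_ciSup (bdd a) N) (apply_nonneg N.1 a) (nonneg a)) ?_
      have hM : ∀ N : {N : CStarSeminorm 𝒜 // N.Respects rel}, N.1 a * N.1 a ≤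
          ⨆ N : {N : CStarSeminorm 𝒜 // N.Respects rel}, N.1 a * N.1 a := by
        refine le_ciSup ?_
        obtain ⟨C, hC⟩ := h (star a * a)
        exact ⟨C, by rintro _ ⟨N, rfl⟩; exact (N.1.star_mul_self a).ge.trans (hC N.1 N.2)⟩
      have hs := ciSup_le fun N => Real.le_sqrt_of_sq_le ((sq _).trans_le (hM N))
      refine (mul_le_mul hs hs (nonneg a) (Real.sqrt_nonneg _)).trans (Real.mul_self_sqrt ?_).le
      exact Real.iSup_nonneg fun N => mul_self_nonneg _ }

theorem le_maximal {rel : 𝒜 → 𝒜 → Prop} (h : Bounded rel) (N : CStarSeminorm 𝒜)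
    (hN : N.Respects rel) (a : 𝒜) : N a ≤ maximal rel h a :=
  le_ciSup (f := fun N : {N : CStarSeminorm 𝒜 // N.Respects rel} => N.1 a)
    (by
      obtain ⟨C, hC⟩ := h a
      exact ⟨C, by rintro _ ⟨N, rfl⟩; exact hC N.1 N.2⟩) ⟨N, hN⟩

theorem maximal_respects {rel : 𝒜 → 𝒜 → Prop} (h : Bounded rel) : (maximal rel h).Respects rel :=
  fun a b hab => by
    change (⨆ N : {N : CStarSeminorm 𝒜 // N.Respects rel}, N.1 (a - b)) = 0
    rw [show (fun N : {N : CStarSeminorm 𝒜 // N.Respects rel} => N.1 (a - b)) = fun _ => 0 from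
      funext fun N => N.2 a b hab]
    exact Real.iSup_const_zero

end CStarSeminorm

/-! ## Universal `C*`-algebras given by generators and relations -/

/-- To bound the `C*`-seminorms respecting some relations it suffices to bound them at the
generators. -/
theorem FreeStarAlgebra.bounded_of_gen {I : Type*}
    {rel : FreeStarAlgebra I → FreeStarAlgebra I → Prop}
    (h : ∀ i, ∃ C : ℝ, ∀ N : CStarSeminorm (FreeStarAlgebra I), N.Respects rel → N (gen i) ≤ C) :
    CStarSeminorm.Bounded rel := by
  intro a
  induction a using FreeStarAlgebra.induction with
  | algebraMap r =>
    refine ⟨‖r‖ * 1, fun N _ => ?_⟩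
    rw [Algebra.algebraMap_eq_smul_one, N.smul]
    refine mul_le_mul_of_nonneg_left ?_ (norm_nonneg r)
    have h1 := N.star_mul_self 1
    rw [star_one, one_mul] at h1
    nlinarith [apply_nonneg N (1 : FreeStarAlgebra I)]
  | gen i => exact h i
  | genStar i =>
    obtain ⟨C, hC⟩ := h i
    exact ⟨C, fun N hN => by rw [← star_gen, N.star_eq]; exact hC N hN⟩
  | mul a b ha hb =>
    obtain ⟨C, hC⟩ := ha
    obtain ⟨D, hD⟩ := hb
    exact ⟨C * D, fun N hN => (map_mul_le_mul N a b).trans (mul_le_mul (hC N hN) (hD N hN)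
      (apply_nonneg N b) ((apply_nonneg N a).trans (hC N hN)))⟩
  | add a b ha hb =>
    obtain ⟨C, hC⟩ := ha
    obtain ⟨D, hD⟩ := hb
    exact ⟨C + D, fun N hN => (map_add_le_add N a b).trans (add_le_add (hC N hN) (hD N hN))⟩

/-- The universal unital `C*`-algebra generated by a family indexed by `I` and subject to the
relations `rel`: the completion of the free `*`-algebra for the largest `C*`-seminorm respecting
the relations. The relations have to bound all `C*`-seminorms. -/
def UniversalCStarAlgebra {I : Type*} (rel : FreeStarAlgebra I → FreeStarAlgebra I → Prop)
    (h : CStarSeminorm.Bounded rel) : Type _ :=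
  (CStarSeminorm.maximal rel h).Envelope

namespace UniversalCStarAlgebra

variable {I : Type*} {rel : FreeStarAlgebra I → FreeStarAlgebra I → Prop}
  (h : CStarSeminorm.Bounded rel)

instance : CStarAlgebra (UniversalCStarAlgebra rel h) :=
  inferInstanceAs (CStarAlgebra (CStarSeminorm.maximal rel h).Envelope)

/-- The image of a `*`-polynomial in the universal `C*`-algebra. -/
def ofFree : FreeStarAlgebra I →⋆ₐ[ℂ] UniversalCStarAlgebra rel h :=
  CStarSeminorm.Envelope.mkHom (CStarSeminorm.maximal rel h)

theorem norm_ofFree (a : FreeStarAlgebra I) : ‖ofFree h a‖ = CStarSeminorm.maximal rel h a :=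
  CStarSeminorm.Envelope.mkHom_apply_norm _ a

theorem denseRange_ofFree : DenseRange (ofFree h) :=
  CStarSeminorm.Envelope.denseRange_mkHom _

/-- The canonical generators. -/
def gen (i : I) : UniversalCStarAlgebra rel h := ofFree h (FreeStarAlgebra.gen i)

theorem ofFree_eq {p q : FreeStarAlgebra I} (hpq : rel p q) : ofFree h p = ofFree h q := by
  rw [← sub_eq_zero, ← map_sub, ← norm_eq_zero, norm_ofFree]
  exact CStarSeminorm.maximal_respects h p q hpq

variable {B : Type*} [CStarAlgebra B]

/-- The universal property: a family in a `C*`-algebra satisfying the relations defines a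
`*`-homomorphism. -/
def lift (f : I → B)
    (hf : ∀ p q, rel p q → FreeStarAlgebra.lift f p = FreeStarAlgebra.lift f q) :
    UniversalCStarAlgebra rel h →⋆ₐ[ℂ] B :=
  CStarSeminorm.Envelope.lift _ (FreeStarAlgebra.lift f) fun a =>
    CStarSeminorm.le_maximal h (CStarSeminorm.ofStarAlgHom (FreeStarAlgebra.lift f))
      (fun p q hpq => by
        change ‖FreeStarAlgebra.lift f (p - q)‖ = 0
        rw [map_sub, hf p q hpq, sub_self, norm_zero]) a

theorem lift_ofFree (f : I → B)
    (hf : ∀ p q, rel p q → FreeStarAlgebra.lift f p = FreeStarAlgebra.lift f q)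
    (a : FreeStarAlgebra I) : lift h f hf (ofFree h a) = FreeStarAlgebra.lift f a :=
  CStarSeminorm.Envelope.lift_mkHom _ _ _ a

@[simp] theorem lift_gen (f : I → B)
    (hf : ∀ p q, rel p q → FreeStarAlgebra.lift f p = FreeStarAlgebra.lift f q) (i : I) :
    lift h f hf (gen h i) = f i := by
  rw [gen, lift_ofFree, FreeStarAlgebra.lift_gen]

/-- An element commuting with the images of all generators and their adjoints commutes with the
whole image. -/
theorem commute_of_gen {C : Type*} [CStarAlgebra C] (F : UniversalCStarAlgebra rel h →⋆ₐ[ℂ] C)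
    (c : C) (h₁ : ∀ i, Commute (F (gen h i)) c) (h₂ : ∀ i, Commute (star (F (gen h i))) c)
    (a : UniversalCStarAlgebra rel h) : Commute (F a) c := by
  have hF : Continuous F := (AddMonoidHomClass.continuous_of_bound F 1 fun a => by
    rw [one_mul]; exact NonUnitalStarAlgHom.norm_apply_le F a)
  refine (denseRange_ofFree h).induction_on (p := fun a => F a * c = c * F a) a
    (isClosed_eq (hF.mul continuous_const) (continuous_const.mul hF)) fun a => ?_
  change Commute (F (ofFree h a)) c
  induction a using FreeStarAlgebra.induction with
  | algebraMap r =>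
    rw [AlgHomClass.commutes, AlgHomClass.commutes]
    exact Algebra.commute_algebraMap_left r c
  | gen i => exact h₁ i
  | genStar i =>
    rw [← FreeStarAlgebra.star_gen, map_star, map_star]
    exact h₂ i
  | mul a b ha hb =>
    rw [map_mul, map_mul]
    exact ha.mul_left hb
  | add a b ha hb =>
    rw [map_add, map_add]
    exact ha.add_left hb

end UniversalCStarAlgebra

/-! ## Copies of a `C*`-algebra among the generators -/

/-- The relations saying that the family `e` of `*`-polynomials indexed by the elements of `A` is
a unital `*`-homomorphism on `A`. -/
inductive StarHomRel {A I : Type*} [CStarAlgebra A] (e : A → FreeStarAlgebra I) :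
    FreeStarAlgebra I → FreeStarAlgebra I → Prop
  | one : StarHomRel e (e 1) 1
  | add (a b : A) : StarHomRel e (e (a + b)) (e a + e b)
  | mul (a b : A) : StarHomRel e (e (a * b)) (e a * e b)
  | smul (c : ℂ) (a : A) : StarHomRel e (e (c • a)) (c • e a)
  | star (a : A) : StarHomRel e (e (star a)) (star (e a))

namespace StarHomRel

variable {A I : Type*} [CStarAlgebra A] {e : A → FreeStarAlgebra I}

theorem mkHom_eq (N : CStarSeminorm (FreeStarAlgebra I)) (hN : N.Respects (StarHomRel e))
    {p q : FreeStarAlgebra I} (h : StarHomRel e p q) :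
    CStarSeminorm.Envelope.mkHom N p = CStarSeminorm.Envelope.mkHom N q := by
  rw [← sub_eq_zero, ← map_sub, ← norm_eq_zero, CStarSeminorm.Envelope.mkHom_apply_norm]
  exact hN p q h

/-- The `*`-homomorphism on `A` defined by a seminorm respecting the relations. -/
def toHom (N : CStarSeminorm (FreeStarAlgebra I)) (hN : N.Respects (StarHomRel e)) :
    A →⋆ₐ[ℂ] N.Envelope :=
  have h1 : CStarSeminorm.Envelope.mkHom N (e 1) = 1 := (mkHom_eq N hN .one).trans (map_one _)
  have hs : ∀ (c : ℂ) (a : A), CStarSeminorm.Envelope.mkHom N (e (c • a)) =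
      c • CStarSeminorm.Envelope.mkHom N (e a) := fun c a =>
    (mkHom_eq N hN (.smul c a)).trans (map_smul _ c (e a))
  { toFun := fun a => CStarSeminorm.Envelope.mkHom N (e a)
    map_one' := h1
    map_mul' := fun a b => (mkHom_eq N hN (.mul a b)).trans (map_mul _ _ _)
    map_zero' := by simpa using hs 0 0
    map_add' := fun a b => (mkHom_eq N hN (.add a b)).trans (map_add _ _ _)
    commutes' := fun c => by
      rw [Algebra.algebraMap_eq_smul_one, hs, h1, Algebra.algebraMap_eq_smul_one]
    map_star' := fun a => (mkHom_eq N hN (.star a)).trans (map_star _ _) }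

theorem seminorm_le (N : CStarSeminorm (FreeStarAlgebra I)) (hN : N.Respects (StarHomRel e))
    (a : A) : N (e a) ≤ ‖a‖ := by
  rw [← CStarSeminorm.Envelope.mkHom_apply_norm]
  exact NonUnitalStarAlgHom.norm_apply_le (toHom N hN) a

theorem lift_eq {B : Type*} [CStarAlgebra B] {f : I → B} (F : A →⋆ₐ[ℂ] B)
    (hF : ∀ a, FreeStarAlgebra.lift f (e a) = F a) {p q : FreeStarAlgebra I}
    (h : StarHomRel e p q) : FreeStarAlgebra.lift f p = FreeStarAlgebra.lift f q := by
  cases h <;> simp [hF, map_star]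

/-- The `*`-homomorphism from `A` to a universal `C*`-algebra given by a copy of `A` among the
generators. -/
def toUniversal {rel : FreeStarAlgebra I → FreeStarAlgebra I → Prop}
    (h : CStarSeminorm.Bounded rel) (e : A → FreeStarAlgebra I)
    (he : ∀ p q, StarHomRel e p q → rel p q) : A →⋆ₐ[ℂ] UniversalCStarAlgebra rel h :=
  toHom (CStarSeminorm.maximal rel h)
    fun p q hpq => CStarSeminorm.maximal_respects h p q (he p q hpq)

end StarHomRel

/-! ## The maximal tensor product -/

namespace MaxTensorProduct

section rel

variable (A B : Type*) [CStarAlgebra A] [CStarAlgebra B]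

/-- Relations defining the maximal tensor product: a copy of `A` and a copy of `B` commute. -/
inductive Rel : FreeStarAlgebra (A ⊕ B) → FreeStarAlgebra (A ⊕ B) → Prop
  | left (p q) : StarHomRel (fun a : A => FreeStarAlgebra.gen (Sum.inl a)) p q → Rel p q
  | right (p q) : StarHomRel (fun b : B => FreeStarAlgebra.gen (Sum.inr b)) p q → Rel p q
  | comm (a : A) (b : B) : Rel
      (FreeStarAlgebra.gen (Sum.inl a) * FreeStarAlgebra.gen (Sum.inr b))
      (FreeStarAlgebra.gen (Sum.inr b) * FreeStarAlgebra.gen (Sum.inl a))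

theorem bounded : CStarSeminorm.Bounded (Rel A B) :=
  FreeStarAlgebra.bounded_of_gen fun
    | .inl a => ⟨‖a‖, fun N hN => StarHomRel.seminorm_le
        (e := fun a : A => FreeStarAlgebra.gen (Sum.inl a)) N
        (fun p q h => hN p q (.left p q h)) a⟩
    | .inr b => ⟨‖b‖, fun N hN => StarHomRel.seminorm_le
        (e := fun b : B => FreeStarAlgebra.gen (Sum.inr b)) N
        (fun p q h => hN p q (.right p q h)) b⟩

end rel

end MaxTensorProduct

/-- The maximal `C*`-tensor product of two unital `C*`-algebras: the universal `C*`-algebra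
generated by a copy of `A` and a copy of `B` that commute with each other. -/
def MaxTensorProduct (A B : Type*) [CStarAlgebra A] [CStarAlgebra B] : Type _ :=
  UniversalCStarAlgebra (MaxTensorProduct.Rel A B) (MaxTensorProduct.bounded A B)

namespace MaxTensorProduct

variable {A B C D : Type*} [CStarAlgebra A] [CStarAlgebra B] [CStarAlgebra C] [CStarAlgebra D]

instance : CStarAlgebra (MaxTensorProduct A B) :=
  inferInstanceAs (CStarAlgebra (UniversalCStarAlgebra (Rel A B) (bounded A B)))

/-- The embedding `a ↦ a ⊗ 1`. -/
def inl : A →⋆ₐ[ℂ] MaxTensorProduct A B :=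
  StarHomRel.toUniversal (bounded A B) (fun a : A => FreeStarAlgebra.gen (Sum.inl a)) .left

/-- The embedding `b ↦ 1 ⊗ b`. -/
def inr : B →⋆ₐ[ℂ] MaxTensorProduct A B :=
  StarHomRel.toUniversal (bounded A B) (fun b : B => FreeStarAlgebra.gen (Sum.inr b)) .right

/-- The elementary tensor `a ⊗ b`. -/
def tmul (a : A) (b : B) : MaxTensorProduct A B := inl a * inr b

theorem commute_inl_inr (a : A) (b : B) : Commute (inl a : MaxTensorProduct A B) (inr b) := by
  have h := UniversalCStarAlgebra.ofFree_eq (bounded A B) (Rel.comm a b)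
  rw [map_mul, map_mul] at h
  exact h

/-- The `*`-homomorphism `a ⊗ b ↦ f a * g b` defined by commuting `*`-homomorphisms. -/
def lift (f : A →⋆ₐ[ℂ] C) (g : B →⋆ₐ[ℂ] C) (hfg : ∀ a b, Commute (f a) (g b)) :
    MaxTensorProduct A B →⋆ₐ[ℂ] C :=
  UniversalCStarAlgebra.lift (bounded A B) (Sum.elim f g) fun _ _ hpq => by
    cases hpq with
    | left _ _ h => exact StarHomRel.lift_eq f (fun a => by simp) h
    | right _ _ h => exact StarHomRel.lift_eq g (fun b => by simp) h
    | comm a b => simpa using (hfg a b).eq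

@[simp] theorem lift_inl (f : A →⋆ₐ[ℂ] C) (g : B →⋆ₐ[ℂ] C) (hfg : ∀ a b, Commute (f a) (g b))
    (a : A) : lift f g hfg (inl a) = f a :=
  UniversalCStarAlgebra.lift_gen (bounded A B) (Sum.elim f g) _ (Sum.inl a)

@[simp] theorem lift_inr (f : A →⋆ₐ[ℂ] C) (g : B →⋆ₐ[ℂ] C) (hfg : ∀ a b, Commute (f a) (g b))
    (b : B) : lift f g hfg (inr b) = g b :=
  UniversalCStarAlgebra.lift_gen (bounded A B) (Sum.elim f g) _ (Sum.inr b)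

theorem commute_of (F : MaxTensorProduct A B →⋆ₐ[ℂ] C) (c : C)
    (h₁ : ∀ a, Commute (F (inl a)) c) (h₂ : ∀ b, Commute (F (inr b)) c)
    (x : MaxTensorProduct A B) : Commute (F x) c := by
  refine UniversalCStarAlgebra.commute_of_gen (bounded A B) F c ?_ ?_ x
  · rintro (a | b)
    · exact h₁ a
    · exact h₂ b
  · rintro (a | b)
    · have h := h₁ (star a)
      rw [map_star, map_star] at h
      exact h
    · have h := h₂ (star b)
      rw [map_star, map_star] at h
      exact h

theorem commute_comp (f : A →⋆ₐ[ℂ] C) (g : B →⋆ₐ[ℂ] D) (a : A) (b : B) :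
    Commute ((inl : C →⋆ₐ[ℂ] MaxTensorProduct C D).comp f a)
      ((inr : D →⋆ₐ[ℂ] MaxTensorProduct C D).comp g b) := by
  rw [StarAlgHom.comp_apply, StarAlgHom.comp_apply]
  exact commute_inl_inr (f a) (g b)

/-- The tensor product `f ⊗ g` of two `*`-homomorphisms. -/
def map (f : A →⋆ₐ[ℂ] C) (g : B →⋆ₐ[ℂ] D) : MaxTensorProduct A B →⋆ₐ[ℂ] MaxTensorProduct C D :=
  lift (inl.comp f) (inr.comp g) (commute_comp f g)

@[simp] theorem map_inl (f : A →⋆ₐ[ℂ] C) (g : B →⋆ₐ[ℂ] D) (a : A) :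
    map f g (inl a) = inl (f a) := lift_inl _ _ (commute_comp f g) a

@[simp] theorem map_inr (f : A →⋆ₐ[ℂ] C) (g : B →⋆ₐ[ℂ] D) (b : B) :
    map f g (inr b) = inr (g b) := lift_inr _ _ (commute_comp f g) b

theorem commute_assoc (x : MaxTensorProduct A B) (c : C) :
    Commute (map (StarAlgHom.id ℂ A) (inl : B →⋆ₐ[ℂ] MaxTensorProduct B C) x)
      ((inr : MaxTensorProduct B C →⋆ₐ[ℂ] MaxTensorProduct A (MaxTensorProduct B C)).comp inr c) := by
  rw [StarAlgHom.comp_apply]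
  refine commute_of _ _ (fun a => ?_) (fun b => ?_) x
  · rw [map_inl]; exact commute_inl_inr _ _
  · rw [map_inr]; exact (commute_inl_inr b c).map inr

/-- The associativity map `(a ⊗ b) ⊗ c ↦ a ⊗ (b ⊗ c)`. -/
def assoc (A B C : Type*) [CStarAlgebra A] [CStarAlgebra B] [CStarAlgebra C] :
    MaxTensorProduct (MaxTensorProduct A B) C →⋆ₐ[ℂ]
      MaxTensorProduct A (MaxTensorProduct B C) :=
  lift (map (StarAlgHom.id ℂ A) inl) (inr.comp inr) commute_assoc

end MaxTensorProduct

/-! ## Magic unitaries and Hopf `C*`-algebras -/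

/-- A magic unitary: all entries are projections, and every row and every column is a partition of
unity, that is, consists of pairwise orthogonal projections with sum `1`. -/
structure IsMagicUnitary {A ι : Type*} [Ring A] [StarRing A] [Fintype ι]
    (u : Matrix ι ι A) : Prop where
  isStarProjection : ∀ i j, IsStarProjection (u i j)
  row_orthogonal : ∀ i j k, j ≠ k → u i j * u i k = 0
  col_orthogonal : ∀ i j k, j ≠ k → u j i * u k i = 0
  row_sum : ∀ i, ∑ j, u i j = 1
  col_sum : ∀ i, ∑ j, u j i = 1

/-- The homomorphism `ℂ → A`, composed with a character. -/
def StarAlgHom.scalar {A B : Type*} [CStarAlgebra A] [CStarAlgebra B] (χ : A →⋆ₐ[ℂ] ℂ) :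
    A →⋆ₐ[ℂ] B :=
  (StarAlgHom.ofId ℂ B).comp χ

theorem StarAlgHom.commute_scalar {A B : Type*} [CStarAlgebra A] [CStarAlgebra B]
    (χ : A →⋆ₐ[ℂ] ℂ) (a : A) (b : B) : Commute (StarAlgHom.scalar χ a : B) b :=
  Algebra.commute_algebraMap_left (χ a) b

/-- A Hopf `C*`-algebra structure on a unital `C*`-algebra `A`: a comultiplication
`Δ : A → A ⊗ A`, a counit `ε : A → ℂ` and an antipode `S : A → Aᵒᵖ` satisfying the usual axioms,
with `S² = id`. As usual, since multiplication is not a map on the `C*`-tensor product, the antipode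
axiom is required on a dense `*`-subalgebra that `Δ` maps to its algebraic tensor square. -/
@[ext]
structure HopfCStarStructure (A : Type*) [CStarAlgebra A] where
  /-- The comultiplication. -/
  comul : A →⋆ₐ[ℂ] MaxTensorProduct A A
  /-- The counit. -/
  counit : A →⋆ₐ[ℂ] ℂ
  /-- The antipode. -/
  antipode : A →⋆ₐ[ℂ] Aᵐᵒᵖ
  coassoc : ∀ a, MaxTensorProduct.assoc A A A
      (MaxTensorProduct.map comul (StarAlgHom.id ℂ A) (comul a)) =
    MaxTensorProduct.map (StarAlgHom.id ℂ A) comul (comul a)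
  /-- `(ε ⊗ id) Δ = id`. -/
  counit_comul : ∀ a, MaxTensorProduct.lift (StarAlgHom.scalar counit) (StarAlgHom.id ℂ A)
    (StarAlgHom.commute_scalar counit) (comul a) = a
  /-- `(id ⊗ ε) Δ = id`. -/
  comul_counit : ∀ a, MaxTensorProduct.lift (StarAlgHom.id ℂ A) (StarAlgHom.scalar counit)
    (fun a b => (StarAlgHom.commute_scalar counit b a).symm) (comul a) = a
  /-- `m (S ⊗ id) Δ = ε 1 = m (id ⊗ S) Δ` on a dense `*`-subalgebra. -/
  antipode_comul : ∃ 𝒜 : StarSubalgebra ℂ A, Dense (𝒜 : Set A) ∧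
    (∀ a ∈ 𝒜, (antipode a).unop ∈ 𝒜) ∧
    ∀ a ∈ 𝒜, ∃ (n : ℕ) (x y : Fin n → A), (∀ k, x k ∈ 𝒜 ∧ y k ∈ 𝒜) ∧
      comul a = ∑ k, MaxTensorProduct.tmul (x k) (y k) ∧
      ∑ k, (antipode (x k)).unop * y k = algebraMap ℂ A (counit a) ∧
      ∑ k, x k * (antipode (y k)).unop = algebraMap ℂ A (counit a)
  /-- `S² = id`. -/
  antipode_antipode : ∀ a, (antipode (antipode a).unop).unop = a

/-- The matrix `u` is a magic unitary, it is multiplicative for the Hopf `C*`-algebra structure `H`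
(the formulas for `Δ` and `ε`), and the antipode is given by `S(u i j) = u j i`. -/
structure HopfCStarStructure.IsMultiplicativeMagic {A ι : Type*} [CStarAlgebra A] [Fintype ι]
    [DecidableEq ι] (H : HopfCStarStructure A) (u : Matrix ι ι A) : Prop where
  isMagicUnitary : IsMagicUnitary u
  comul : ∀ i j, H.comul (u i j) = ∑ k, MaxTensorProduct.tmul (u i k) (u k j)
  counit : ∀ i j, H.counit (u i j) = if i = j then 1 else 0
  antipode : ∀ i j, H.antipode (u i j) = MulOpposite.op (u j i)

/-- A `*`-isomorphism is an isomorphism of Hopf `C*`-algebras. -/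
structure HopfCStarStructure.IsIso {A B : Type*} [CStarAlgebra A] [CStarAlgebra B]
    (H : HopfCStarStructure A) (K : HopfCStarStructure B) (Φ : A ≃⋆ₐ[ℂ] B) : Prop where
  comul : ∀ a, K.comul (Φ a) =
    MaxTensorProduct.map (Φ : A →⋆ₐ[ℂ] B) (Φ : A →⋆ₐ[ℂ] B) (H.comul a)
  counit : ∀ a, K.counit (Φ a) = H.counit a
  antipode : ∀ a, K.antipode (Φ a) = MulOpposite.op (Φ (H.antipode a).unop)

/-! ## The quantum automorphism group of a graph -/

namespace QuantumAutomorphism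

variable {V : Type*} [Fintype V]

/-- The matrix of generators of the free `*`-algebra on `V × V`. -/
def genMatrix (V : Type*) : Matrix V V (FreeStarAlgebra (V × V)) :=
  Matrix.of fun i j => FreeStarAlgebra.gen (i, j)

open scoped Classical in
/-- The relations of `A(X)`: the matrix `u` of generators is a magic unitary and `d u = u d` for
the adjacency matrix `d` of the graph `X`. -/
inductive Rel (X : SimpleGraph V) :
    FreeStarAlgebra (V × V) → FreeStarAlgebra (V × V) → Prop
  | star (i j) : Rel X (star (genMatrix V i j)) (genMatrix V i j)
  | idem (i j) : Rel X (genMatrix V i j * genMatrix V i j) (genMatrix V i j)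
  | row_orthogonal (i j k) (h : j ≠ k) : Rel X (genMatrix V i j * genMatrix V i k) 0
  | col_orthogonal (i j k) (h : j ≠ k) : Rel X (genMatrix V j i * genMatrix V k i) 0
  | row_sum (i) : Rel X (∑ j, genMatrix V i j) 1
  | col_sum (i) : Rel X (∑ j, genMatrix V j i) 1
  | adj (i j) : Rel X ((X.adjMatrix (FreeStarAlgebra (V × V)) * genMatrix V) i j)
      ((genMatrix V * X.adjMatrix (FreeStarAlgebra (V × V))) i j)

theorem bounded (X : SimpleGraph V) : CStarSeminorm.Bounded (Rel X) :=
  FreeStarAlgebra.bounded_of_gen fun ⟨i, j⟩ => ⟨1, fun N hN => by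
    have h1 := hN _ _ (.star i j)
    have h2 := hN _ _ (.idem i j)
    set g : FreeStarAlgebra (V × V) := genMatrix V i j
    change N g ≤ 1
    have h3 : N (star g * g) ≤ N g := by
      have : star g * g = (star g - g) * g + ((g * g - g) + g) := by noncomm_ring
      rw [this]
      refine (map_add_le_add N _ _).trans ?_
      have h4 := map_mul_le_mul N (star g - g) g
      have h5 := map_add_le_add N (g * g - g) g
      rw [h1, zero_mul] at h4
      rw [h2, zero_add] at h5
      linarith
    rw [N.star_mul_self] at h3
    nlinarith [apply_nonneg N g]⟩

end QuantumAutomorphism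

/-- The algebra `A(X)` of the quantum automorphism group of a finite graph `X`: the universal
`C*`-algebra generated by the entries of a magic unitary commuting with the adjacency matrix. -/
def QuantumAutomorphismAlgebra {V : Type*} [Fintype V] (X : SimpleGraph V) : Type _ :=
  UniversalCStarAlgebra (QuantumAutomorphism.Rel X) (QuantumAutomorphism.bounded X)

namespace QuantumAutomorphismAlgebra

variable {V : Type*} [Fintype V] (X : SimpleGraph V)

instance : CStarAlgebra (QuantumAutomorphismAlgebra X) :=
  inferInstanceAs (CStarAlgebra
    (UniversalCStarAlgebra (QuantumAutomorphism.Rel X) (QuantumAutomorphism.bounded X)))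

/-- The universal magic unitary of `A(X)`. -/
def magic : Matrix V V (QuantumAutomorphismAlgebra X) :=
  Matrix.of fun i j => UniversalCStarAlgebra.gen (QuantumAutomorphism.bounded X) (i, j)

end QuantumAutomorphismAlgebra

/-! ## Free wreath products -/

namespace FreeWreathProduct

section rel

variable {A B ι κ : Type*} [CStarAlgebra A] [CStarAlgebra B]

/-- The generator given by the element `x` in the `a`-th copy of `A`. -/
def copyGen (a : κ) (x : A) : FreeStarAlgebra ((κ × A) ⊕ B) :=
  FreeStarAlgebra.gen (Sum.inl (a, x))

/-- The generator given by the element `y` of `B`. -/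
def baseGen (y : B) : FreeStarAlgebra ((κ × A) ⊕ B) := FreeStarAlgebra.gen (Sum.inr y)

/-- The relations of `A *_w B`: there is a copy of `A` for each index `a` of `v` and a copy of `B`,
and the entries of `u` in the `a`-th copy of `A` commute with the `a`-th row of `v`. -/
inductive Rel (u : Matrix ι ι A) (v : Matrix κ κ B) :
    FreeStarAlgebra ((κ × A) ⊕ B) → FreeStarAlgebra ((κ × A) ⊕ B) → Prop
  | copy (a : κ) (p q) : StarHomRel (copyGen (B := B) a) p q → Rel u v p q
  | base (p q) : StarHomRel (baseGen (κ := κ) (A := A)) p q → Rel u v p q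
  | comm (a b : κ) (i j : ι) : Rel u v (copyGen a (u i j) * baseGen (v a b))
      (baseGen (v a b) * copyGen a (u i j))

theorem bounded (u : Matrix ι ι A) (v : Matrix κ κ B) : CStarSeminorm.Bounded (Rel u v) :=
  FreeStarAlgebra.bounded_of_gen fun
    | .inl (a, x) => ⟨‖x‖, fun N hN => StarHomRel.seminorm_le (e := copyGen (B := B) a) N
        (fun p q h => hN p q (.copy a p q h)) x⟩
    | .inr y => ⟨‖y‖, fun N hN => StarHomRel.seminorm_le (e := baseGen (κ := κ) (A := A)) N
        (fun p q h => hN p q (.base p q h)) y⟩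

end rel

end FreeWreathProduct

/-- The free wreath product `A *_w B` of `(A, u)` and `(B, v)`: the quotient of the free product
of copies of `A`, indexed by the rows of `v`, and `B`, by the relations `[u i j ^ (a), v a b] = 0`. -/
def FreeWreathProduct {A B ι κ : Type*} [CStarAlgebra A] [CStarAlgebra B]
    (u : Matrix ι ι A) (v : Matrix κ κ B) : Type _ :=
  UniversalCStarAlgebra (FreeWreathProduct.Rel u v) (FreeWreathProduct.bounded u v)

namespace FreeWreathProduct

variable {A B ι κ : Type*} [CStarAlgebra A] [CStarAlgebra B]
  (u : Matrix ι ι A) (v : Matrix κ κ B)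

instance : CStarAlgebra (FreeWreathProduct u v) :=
  inferInstanceAs (CStarAlgebra
    (UniversalCStarAlgebra (FreeWreathProduct.Rel u v) (FreeWreathProduct.bounded u v)))

/-- The `a`-th copy of `A`. -/
def copy (a : κ) : A →⋆ₐ[ℂ] FreeWreathProduct u v :=
  StarHomRel.toUniversal (bounded u v) (copyGen (B := B) a) (.copy a)

/-- The copy of `B`. -/
def base : B →⋆ₐ[ℂ] FreeWreathProduct u v :=
  StarHomRel.toUniversal (bounded u v) (baseGen (κ := κ) (A := A)) .base

/-- The magic unitary `w (i, a) (j, b) = u i j ^ (a) * v a b`. -/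
def magic : Matrix (ι × κ) (ι × κ) (FreeWreathProduct u v) :=
  Matrix.of fun p q => copy u v p.2 (u p.1 q.1) * base u v (v p.2 q.2)

end FreeWreathProduct

/-! ## Finite groups and circulant graphs -/

/-- For a finite group `G` acting on a finite set through `ρ`, the matrix over the algebra `C(G)` of
complex functions on `G` whose entries are the characteristic functions of the sets
`{σ | σ j = i}`. -/
def permutationMagic {G ι : Type*} [Group G] [DecidableEq ι] (ρ : G →* Equiv.Perm ι) :
    Matrix ι ι (G → ℂ) :=
  Matrix.of fun i j σ => if ρ σ j = i then 1 else 0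

/-- The cyclic group `ℤ/n` acting on itself by translation. -/
def cyclicPerm (n : ℕ) : Multiplicative (ZMod n) →* Equiv.Perm (ZMod n) where
  toFun g := Equiv.addLeft g.toAdd
  map_one' := by ext; simp
  map_mul' g h := by ext; simp

/-- The dihedral group acting on the vertices of the `n`-gon: `r i` is the rotation `x ↦ x + i` and
`sr i` is the reflection `x ↦ -(x + i)`. -/
def dihedralPerm (n : ℕ) : DihedralGroup n →* Equiv.Perm (ZMod n) where
  toFun
    | .r i => Equiv.addRight i
    | .sr i => (Equiv.addRight i).trans (Equiv.neg _)
  map_one' := Equiv.ext fun x => add_zero x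
  map_mul' := by
    rintro (i | i) (j | j) <;> ext x <;> simp <;> abel

/-- The cycle with chords `C_n(K)`: the `n`-cycle, with all pairs of vertices at distance `k` joined
for all `k ∈ K`. -/
def cycleWithChords (n : ℕ) (K : Set ℕ) : SimpleGraph (ZMod n) :=
  SimpleGraph.circulantGraph (insert 1 ((fun k : ℕ => (k : ZMod n)) '' K))

end

/-! By the Chinese remainder theorem `ℤ/10 ≅ ℤ/2 × ℤ/5`, and the differences `±1, ±4` are exactly
those whose class mod 5 is `±1`. So `C₁₀(4)` is the pentagon with each vertex replaced by two
non-adjacent twins (`cycleWithChords_adj_iff`).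

Let `M` be a magic unitary over `ℤ/2 × ℤ/5` commuting with the adjacency matrix. In the commutation
relation one side does not involve the row index in `ℤ/2`, and the other does not involve the column
index. The adjacency matrix of the pentagon is injective (`pentagon_kernel`), so the row sums and
the column sums of each `2 × 2` block are all equal to one projection `V a b`
(`sum_col_eq_sum_row`). Then `V` is a magic unitary commuting with the pentagon, the sums `U^(a) i j
= ∑ b, M (i, a) (j, b)` form a magic unitary of size two for each `a`, and `M (i, a) (j, b) = U^(a)
i j * V a b = V a b * U^(a) i j`. Conversely, every such product matrix commutes with the adjacency
matrix.

It remains to recognise the two factors. A magic unitary of size two is circulant, hence comes from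
`C(ℤ/2)`. The pentagon has no quantum symmetry: by `commute_add_one`, neighbouring entries of `V`
commute, their products are projections attached to the rotations and reflections, and these form a
partition of unity indexed by `D₅`. Thus both algebras have the same universal property, with `W`
corresponding to `w`.

The Hopf structures need little more. Everything is determined on a generating magic unitary; on
`A(X)` the maps `Δ`, `ε`, `S` come from the universal property (`exists_isMultiplicativeMagic`
checks the axioms), and the structure on the wreath product is transported along the isomorphism. -/

noncomputable section

/-! ## Continuity and generation -/

namespace StarAlgHom

variable {A B : Type*} [CStarAlgebra A] [CStarAlgebra B]

theorem continuous_of_cstarAlgebra (f : A →⋆ₐ[ℂ] B) : Continuous f :=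
  AddMonoidHomClass.continuous_of_bound f 1 fun a => by
    rw [one_mul]; exact NonUnitalStarAlgHom.norm_apply_le f a

end StarAlgHom

/-- The entries of the matrix `u` generate `A` as a `C*`-algebra. -/
def Matrix.Generates {A ι : Type*} [CStarAlgebra A] (u : Matrix ι ι A) : Prop :=
  Dense (StarAlgebra.adjoin ℂ (Set.range fun p : ι × ι => u p.1 p.2) : Set A)

namespace Matrix.Generates

variable {A B ι : Type*} [CStarAlgebra A] [CStarAlgebra B] {u : Matrix ι ι A}

theorem starAlgHom_ext (hu : u.Generates) {f g : A →⋆ₐ[ℂ] B} (h : ∀ i j, f (u i j) = g (u i j)) :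
    f = g := by
  have hfg : Set.EqOn f g (StarAlgebra.adjoin ℂ (Set.range fun p : ι × ι => u p.1 p.2)) := by
    intro x hx
    have : StarAlgebra.adjoin ℂ (Set.range fun p : ι × ι => u p.1 p.2) ≤
        StarAlgHom.equalizer f g := by
      rw [StarAlgebra.adjoin_le_iff]
      rintro _ ⟨p, rfl⟩
      exact h p.1 p.2
    exact this hx
  exact DFunLike.coe_injective
    (Continuous.ext_on hu f.continuous_of_cstarAlgebra g.continuous_of_cstarAlgebra hfg)

/-- A surjective continuous map sends dense sets to dense sets. This yields generation by `w` in the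
wreath product from generation by `W` in `A(X)`. -/
theorem map {ι' : Type*} (hu : u.Generates) {f : A →⋆ₐ[ℂ] B} (hf : Function.Surjective f)
    {w : Matrix ι' ι' B} (e : ι' ≃ ι) (h : ∀ p q, f (u (e p) (e q)) = w p q) : w.Generates := by
  refine (hf.denseRange.dense_image f.continuous_of_cstarAlgebra hu).mono ?_
  rintro _ ⟨x, hx, rfl⟩
  have : StarAlgebra.adjoin ℂ (Set.range fun p : ι × ι => u p.1 p.2) ≤
      (StarAlgebra.adjoin ℂ (Set.range fun p : ι' × ι' => w p.1 p.2)).comap f := by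
    rw [StarAlgebra.adjoin_le_iff]
    rintro _ ⟨p, rfl⟩
    refine StarAlgebra.subset_adjoin ℂ _ ⟨(e.symm p.1, e.symm p.2), ?_⟩
    simp [← h]
  exact this hx

end Matrix.Generates

/-! ## Magic unitaries -/

namespace IsMagicUnitary

variable {A B ι : Type*} [Fintype ι]

section Ring

variable [Ring A] [StarRing A] [Ring B] [StarRing B] {u : Matrix ι ι A}

theorem star_eq (hu : IsMagicUnitary u) (i j : ι) : star (u i j) = u i j :=
  (hu.isStarProjection i j).isSelfAdjoint

theorem mul_self (hu : IsMagicUnitary u) (i j : ι) : u i j * u i j = u i j :=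
  (hu.isStarProjection i j).isIdempotentElem

theorem row_mul [DecidableEq ι] (hu : IsMagicUnitary u) (i j k : ι) :
    u i j * u i k = if j = k then u i j else 0 := by
  split_ifs with h
  · subst h; exact hu.mul_self i j
  · exact hu.row_orthogonal i j k h

theorem col_mul [DecidableEq ι] (hu : IsMagicUnitary u) (i j k : ι) :
    u j i * u k i = if j = k then u j i else 0 := by
  split_ifs with h
  · subst h; exact hu.mul_self j i
  · exact hu.col_orthogonal i j k h

theorem submatrix {κ : Type*} [Fintype κ] (hu : IsMagicUnitary u) (e : κ ≃ ι) :
    IsMagicUnitary (u.submatrix e e) where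
  isStarProjection _ _ := hu.isStarProjection _ _
  row_orthogonal _ _ _ h := hu.row_orthogonal _ _ _ (e.injective.ne h)
  col_orthogonal _ _ _ h := hu.col_orthogonal _ _ _ (e.injective.ne h)
  row_sum i := (e.sum_comp fun j => u (e i) j).trans (hu.row_sum _)
  col_sum i := (e.sum_comp fun j => u j (e i)).trans (hu.col_sum _)

/-- Transposition exchanges rows and columns, and the opposite product reverses orthogonality
relations. This is the target of the antipode. -/
theorem op_transpose (hu : IsMagicUnitary u) :
    IsMagicUnitary (Matrix.of fun i j => MulOpposite.op (u j i)) where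
  isStarProjection i j :=
    ⟨congrArg MulOpposite.op (hu.mul_self j i), congrArg MulOpposite.op (hu.star_eq j i)⟩
  row_orthogonal i j k h := congrArg MulOpposite.op (hu.col_orthogonal i k j h.symm)
  col_orthogonal i j k h := congrArg MulOpposite.op (hu.row_orthogonal i k j h.symm)
  row_sum i := by
    simpa using congrArg MulOpposite.op (hu.col_sum i)
  col_sum i := by
    simpa using congrArg MulOpposite.op (hu.row_sum i)

theorem one [DecidableEq ι] : IsMagicUnitary (1 : Matrix ι ι A) where
  isStarProjection i j := by
    rw [Matrix.one_apply]
    split_ifs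
    exacts [.one A, .zero A]
  row_orthogonal i j k h := by
    by_cases hj : i = j
    · subst hj; simp [Matrix.one_apply_ne h]
    · simp [Matrix.one_apply_ne hj]
  col_orthogonal i j k h := by
    by_cases hj : j = i
    · subst hj; simp [Matrix.one_apply_ne h.symm]
    · simp [Matrix.one_apply_ne hj]
  row_sum i := by simp [Matrix.one_apply]
  col_sum i := by simp [Matrix.one_apply]

/-- The convolution of two magic unitaries with commuting entries. -/
theorem mul {v : Matrix ι ι A} (hu : IsMagicUnitary u) (hv : IsMagicUnitary v)
    (h : ∀ i j k l, Commute (u i j) (v k l)) : IsMagicUnitary (u * v) := by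
  classical
  -- Commutation separates the `u`-factors from the `v`-factors. Orthogonality of rows of `u` or of
  -- columns of `v` then reduces the double sum to its diagonal.
  have key : ∀ i j i' j', (u * v) i j * (u * v) i' j' =
      ∑ k, ∑ l, (u i k * u i' l) * (v k j * v l j') := by
    intro i j i' j'
    simp only [Matrix.mul_apply, Finset.sum_mul_sum]
    refine Finset.sum_congr rfl fun k _ => Finset.sum_congr rfl fun l _ => ?_
    rw [mul_assoc, ← mul_assoc (v k j), ← (h i' l k j).eq]
    noncomm_ring
  refine ⟨fun i j => ⟨?_, ?_⟩, fun i j k hjk => ?_, fun i j k hjk => ?_, fun i => ?_, fun i => ?_⟩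
  · change (u * v) i j * (u * v) i j = (u * v) i j
    rw [key, Matrix.mul_apply]
    refine Finset.sum_congr rfl fun k _ => ?_
    simp [hu.row_mul, hv.mul_self, ite_mul]
  · change star ((u * v) i j) = (u * v) i j
    rw [Matrix.mul_apply, star_sum]
    exact Finset.sum_congr rfl fun k _ => by
      rw [star_mul, hu.star_eq, hv.star_eq, (h i k k j).eq]
  · rw [key]
    simp [hu.row_mul, hv.row_orthogonal _ _ _ hjk, ite_mul]
  · rw [key]
    simp [hv.col_mul, hu.col_orthogonal _ _ _ hjk, mul_ite]
  · simp only [Matrix.mul_apply]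
    rw [Finset.sum_comm]
    simp [← Finset.mul_sum, hv.row_sum, hu.row_sum]
  · simp only [Matrix.mul_apply]
    rw [Finset.sum_comm]
    simp [← Finset.sum_mul, hv.col_sum, hu.col_sum]

end Ring

theorem map [Ring A] [StarRing A] [Algebra ℂ A] [Ring B] [StarRing B] [Algebra ℂ B]
    {u : Matrix ι ι A} (hu : IsMagicUnitary u) (f : A →⋆ₐ[ℂ] B) : IsMagicUnitary (u.map f) where
  isStarProjection i j := (hu.isStarProjection i j).map f
  row_orthogonal i j k h := by
    simp [← map_mul, hu.row_orthogonal i j k h]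
  col_orthogonal i j k h := by
    simp [← map_mul, hu.col_orthogonal i j k h]
  row_sum i := by simp [← map_sum, hu.row_sum]
  col_sum i := by simp [← map_sum, hu.col_sum]

end IsMagicUnitary

/-! ## Functions on a finite set -/

/-- A finite partition of unity into orthogonal projections, indexed by `G`, is a
`*`-homomorphism on the algebra of functions on `G`. -/
def StarAlgHom.ofPartition {G A : Type*} [Fintype G] [CStarAlgebra A] (p : G → A)
    (hp : ∀ g, IsStarProjection (p g)) (horth : ∀ g h, g ≠ h → p g * p h = 0)
    (hsum : ∑ g, p g = 1) : (G → ℂ) →⋆ₐ[ℂ] A where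
  toFun f := ∑ g, f g • p g
  map_one' := by simpa using hsum
  map_mul' f f' := by
    classical
    rw [Finset.sum_mul_sum]
    refine Finset.sum_congr rfl fun g _ => ?_
    rw [Finset.sum_eq_single g]
    · rw [smul_mul_smul_comm, (hp g).isIdempotentElem.eq, Pi.mul_apply]
    · intro h _ hne
      rw [smul_mul_smul_comm, horth g h hne.symm, smul_zero]
    · simp
  map_zero' := by simp
  map_add' f f' := by simp [add_smul, Finset.sum_add_distrib]
  commutes' c := by
    rw [Algebra.algebraMap_eq_smul_one (A := A) c, ← hsum, Finset.smul_sum]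
    rfl
  map_star' f := by
    rw [star_sum]
    exact Finset.sum_congr rfl fun g _ => by
      rw [star_smul, (hp g).isSelfAdjoint.star_eq, Pi.star_apply]

theorem StarAlgHom.ofPartition_apply {G A : Type*} [Fintype G] [CStarAlgebra A] (p : G → A)
    (hp : ∀ g, IsStarProjection (p g)) (horth : ∀ g h, g ≠ h → p g * p h = 0)
    (hsum : ∑ g, p g = 1) (f : G → ℂ) :
    StarAlgHom.ofPartition p hp horth hsum f = ∑ g, f g • p g := rfl

/-- The indicator functions of points span the functions on a finite set. -/
theorem StarAlgHom.pi_ext {G A : Type*} [Fintype G] [DecidableEq G] [CStarAlgebra A]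
    {f g : (G → ℂ) →⋆ₐ[ℂ] A} (h : ∀ i, f (Pi.single i 1) = g (Pi.single i 1)) : f = g := by
  ext x
  have hx : x = ∑ i, x i • (Pi.single i 1 : G → ℂ) := by
    rw [pi_eq_sum_univ x]
    ext j
    simp [Pi.single_apply, eq_comm]
  rw [hx, map_sum, map_sum]
  simp [h]

theorem isMagicUnitary_permutationMagic {G ι : Type*} [Group G] [Fintype ι] [DecidableEq ι]
    (ρ : G →* Equiv.Perm ι) : IsMagicUnitary (permutationMagic ρ) where
  isStarProjection i j := by
    refine ⟨funext fun σ => ?_, funext fun σ => ?_⟩ <;> simp [permutationMagic, apply_ite star]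
  row_orthogonal i j k h := by
    ext σ
    simp only [permutationMagic, Matrix.of_apply, Pi.mul_apply, Pi.zero_apply]
    split_ifs with h1 h2 <;> simp
    exact h ((ρ σ).injective (h1.trans h2.symm))
  col_orthogonal i j k h := by
    ext σ
    simp only [permutationMagic, Matrix.of_apply, Pi.mul_apply, Pi.zero_apply]
    split_ifs with h1 h2 <;> simp
    exact h (h1.symm.trans h2)
  row_sum i := by
    ext σ
    simp [permutationMagic, ← Equiv.eq_symm_apply]
  col_sum i := by
    ext σ
    simp [permutationMagic]

/-! ## Hopf structures determined by a generating magic unitary -/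

namespace HopfCStarStructure

variable {A B ι : Type*} [CStarAlgebra A] [CStarAlgebra B] [Fintype ι] [DecidableEq ι]

/-- The three structure maps are continuous homomorphisms with prescribed values on generators, and
the remaining fields are propositions. -/
theorem IsMultiplicativeMagic.eq {u : Matrix ι ι A} (hgen : u.Generates)
    {H H' : HopfCStarStructure A} (h : H.IsMultiplicativeMagic u)
    (h' : H'.IsMultiplicativeMagic u) : H = H' :=
  HopfCStarStructure.ext (hgen.starAlgHom_ext fun i j => by rw [h.comul, h'.comul])
    (hgen.starAlgHom_ext fun i j => by rw [h.counit, h'.counit])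
    (hgen.starAlgHom_ext fun i j => by rw [h.antipode, h'.antipode])

/-- The antipode axiom at `a`, with tensor legs in the subalgebra `𝒜`. -/
def AntipodeAt (Δ : A →⋆ₐ[ℂ] MaxTensorProduct A A) (ε : A →⋆ₐ[ℂ] ℂ) (S : A →⋆ₐ[ℂ] Aᵐᵒᵖ)
    (𝒜 : StarSubalgebra ℂ A) (a : A) : Prop :=
  ∃ (n : ℕ) (x y : Fin n → A), (∀ k, x k ∈ 𝒜 ∧ y k ∈ 𝒜) ∧
    Δ a = ∑ k, MaxTensorProduct.tmul (x k) (y k) ∧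
    ∑ k, (S (x k)).unop * y k = algebraMap ℂ A (ε a) ∧
    ∑ k, x k * (S (y k)).unop = algebraMap ℂ A (ε a)

section AntipodeAt

variable {Δ : A →⋆ₐ[ℂ] MaxTensorProduct A A} {ε : A →⋆ₐ[ℂ] ℂ} {S : A →⋆ₐ[ℂ] Aᵐᵒᵖ}
  {𝒜 : StarSubalgebra ℂ A}

/-- Allows arbitrary finite index types in place of `Fin n`, so that sums and products of tensors
can be indexed by `⊕` and `×`. -/
theorem AntipodeAt.of_fintype {κ : Type*} [Fintype κ] {a : A} (x y : κ → A)
    (hmem : ∀ k, x k ∈ 𝒜 ∧ y k ∈ 𝒜) (hΔ : Δ a = ∑ k, MaxTensorProduct.tmul (x k) (y k))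
    (hl : ∑ k, (S (x k)).unop * y k = algebraMap ℂ A (ε a))
    (hr : ∑ k, x k * (S (y k)).unop = algebraMap ℂ A (ε a)) : AntipodeAt Δ ε S 𝒜 a := by
  let e := (Fintype.equivFin κ).symm
  refine ⟨Fintype.card κ, x ∘ e, y ∘ e, fun k => hmem _, ?_, ?_, ?_⟩
  · exact hΔ.trans (e.sum_comp fun k => MaxTensorProduct.tmul (x k) (y k)).symm
  · exact (e.sum_comp fun k => (S (x k)).unop * y k).trans hl
  · exact (e.sum_comp fun k => x k * (S (y k)).unop).trans hr

theorem AntipodeAt.of_algebraMap (c : ℂ) : AntipodeAt Δ ε S 𝒜 (algebraMap ℂ A c) := by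
  refine .of_fintype (κ := Unit) (fun _ => algebraMap ℂ A c) (fun _ => 1)
    (fun _ => ⟨𝒜.algebraMap_mem c, one_mem 𝒜⟩) ?_ ?_ ?_
  · simp [MaxTensorProduct.tmul, AlgHomClass.commutes]
  · simp [AlgHomClass.commutes]
  · simp [AlgHomClass.commutes]

theorem AntipodeAt.add {a b : A} (ha : AntipodeAt Δ ε S 𝒜 a) (hb : AntipodeAt Δ ε S 𝒜 b) :
    AntipodeAt Δ ε S 𝒜 (a + b) := by
  obtain ⟨n, x, y, hmem, hΔ, hl, hr⟩ := ha
  obtain ⟨m, x', y', hmem', hΔ', hl', hr'⟩ := hb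
  refine .of_fintype (κ := Fin n ⊕ Fin m) (Sum.elim x x') (Sum.elim y y')
    (Sum.rec hmem hmem') ?_ ?_ ?_
  · simp [hΔ, hΔ']
  · simp [hl, hl']
  · simp [hr, hr']

/-- Since `S` reverses products, `∑ S(x x') y y' = ∑ S(x') (∑ S(x) y) y'`. The inner sum is the
scalar `ε(a)`, which is central, and the outer sum then gives `ε(b)`. On the other side the inner
scalar is `ε(b)`. -/
theorem AntipodeAt.mul {a b : A} (ha : AntipodeAt Δ ε S 𝒜 a) (hb : AntipodeAt Δ ε S 𝒜 b) :
    AntipodeAt Δ ε S 𝒜 (a * b) := by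
  obtain ⟨n, x, y, hmem, hΔ, hl, hr⟩ := ha
  obtain ⟨m, x', y', hmem', hΔ', hl', hr'⟩ := hb
  refine .of_fintype (κ := Fin n × Fin m) (fun k => x k.1 * x' k.2) (fun k => y k.1 * y' k.2)
    (fun k => ⟨mul_mem (hmem _).1 (hmem' _).1, mul_mem (hmem _).2 (hmem' _).2⟩) ?_ ?_ ?_
  · rw [map_mul, hΔ, hΔ', Finset.sum_mul_sum, Fintype.sum_prod_type]
    refine Finset.sum_congr rfl fun k _ => Finset.sum_congr rfl fun l _ => ?_
    simp only [MaxTensorProduct.tmul, map_mul]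
    rw [mul_assoc, ← mul_assoc (MaxTensorProduct.inr (y k)),
      ← (MaxTensorProduct.commute_inl_inr (x' l) (y k)).eq]
    simp only [mul_assoc]
  · rw [Fintype.sum_prod_type_right]
    have : ∀ l, ∑ k, (S (x k * x' l)).unop * (y k * y' l) =
        (S (x' l)).unop * (∑ k, (S (x k)).unop * y k) * y' l := by
      intro l
      rw [Finset.mul_sum, Finset.sum_mul]
      simp [mul_assoc]
    simp only [this, hl]
    simp only [← Algebra.commutes (ε a), mul_assoc]
    rw [← Finset.mul_sum, hl', map_mul, map_mul]
  · rw [Fintype.sum_prod_type]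
    have : ∀ k, ∑ l, (x k * x' l) * (S (y k * y' l)).unop =
        x k * (∑ l, x' l * (S (y' l)).unop) * (S (y k)).unop := by
      intro l
      rw [Finset.mul_sum, Finset.sum_mul]
      simp [mul_assoc]
    simp only [this, hr']
    simp only [← Algebra.commutes (ε b), mul_assoc]
    rw [← Finset.mul_sum, hr, map_mul, map_mul, Algebra.commutes]

end AntipodeAt

/-- `*`-homomorphisms given by the formulas for `Δ`, `ε`, `S` on a generating magic unitary
define a Hopf structure. -/
theorem exists_isMultiplicativeMagic {u : Matrix ι ι A} (hgen : u.Generates)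
    (hu : IsMagicUnitary u) (Δ : A →⋆ₐ[ℂ] MaxTensorProduct A A) (ε : A →⋆ₐ[ℂ] ℂ)
    (S : A →⋆ₐ[ℂ] Aᵐᵒᵖ)
    (hΔ : ∀ i j, Δ (u i j) = ∑ k, MaxTensorProduct.tmul (u i k) (u k j))
    (hε : ∀ i j, ε (u i j) = if i = j then 1 else 0)
    (hS : ∀ i j, S (u i j) = MulOpposite.op (u j i)) :
    ∃ H : HopfCStarStructure A, H.IsMultiplicativeMagic u := by
  have coassoc : ((MaxTensorProduct.assoc A A A).comp
      (MaxTensorProduct.map Δ (StarAlgHom.id ℂ A))).comp Δ =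
      (MaxTensorProduct.map (StarAlgHom.id ℂ A) Δ).comp Δ := by
    refine hgen.starAlgHom_ext fun i j => ?_
    simp only [StarAlgHom.comp_apply, hΔ, map_sum, MaxTensorProduct.tmul, map_mul,
      MaxTensorProduct.map_inl, MaxTensorProduct.map_inr, StarAlgHom.coe_id, id_eq,
      MaxTensorProduct.assoc, MaxTensorProduct.lift_inl, MaxTensorProduct.lift_inr,
      Finset.sum_mul, Finset.mul_sum, mul_assoc]
    exact Finset.sum_comm
  have counit_comul : (MaxTensorProduct.lift (StarAlgHom.scalar ε) (StarAlgHom.id ℂ A)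
      (StarAlgHom.commute_scalar ε)).comp Δ = StarAlgHom.id ℂ A := by
    refine hgen.starAlgHom_ext fun i j => ?_
    simp [hΔ, MaxTensorProduct.tmul, StarAlgHom.scalar, hε, apply_ite, ite_mul, StarAlgHom.ofId_apply]
  have comul_counit : (MaxTensorProduct.lift (StarAlgHom.id ℂ A) (StarAlgHom.scalar ε)
      (fun a b => (StarAlgHom.commute_scalar ε b a).symm)).comp Δ = StarAlgHom.id ℂ A := by
    refine hgen.starAlgHom_ext fun i j => ?_
    simp [hΔ, MaxTensorProduct.tmul, StarAlgHom.scalar, hε, apply_ite, StarAlgHom.ofId_apply]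
  set G : Set A := Set.range fun p : ι × ι => u p.1 p.2 with hG
  have hmemG : ∀ i j, u i j ∈ StarAlgebra.adjoin ℂ G := fun i j =>
    StarAlgebra.subset_adjoin ℂ _ ⟨(i, j), rfl⟩
  -- The generators are self-adjoint, so the `*`-subalgebra they generate is the plain subalgebra,
  -- and induction over it needs no case for adjoints.
  have hstar : G ∪ star G = G := by
    refine Set.union_eq_self_of_subset_right ?_
    rintro x ⟨p, hp⟩
    exact ⟨p, by rw [← star_star x, ← hp]; exact (hu.star_eq _ _).symm⟩
  have hind : ∀ {P : A → Prop}, (∀ i j, P (u i j)) → (∀ c, P (algebraMap ℂ A c)) →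
      (∀ a b, P a → P b → P (a + b)) → (∀ a b, P a → P b → P (a * b)) →
      ∀ a ∈ StarAlgebra.adjoin ℂ G, P a := by
    intro P h1 h2 h3 h4 a ha
    have ha' : a ∈ Algebra.adjoin ℂ G := by
      rw [← hstar]; exact ha
    induction ha' using Algebra.adjoin_induction with
    | mem x hx => obtain ⟨p, rfl⟩ := hx; exact h1 _ _
    | algebraMap r => exact h2 r
    | add x y hx hy ihx ihy =>
      rw [← hstar] at hx hy
      exact h3 _ _ (ihx hx) (ihy hy)
    | mul x y hx hy ihx ihy =>
      rw [← hstar] at hx hy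
      exact h4 _ _ (ihx hx) (ihy hy)
  -- This and the next identity say that `u` is orthogonal: the antipode axiom on the generators.
  have antipode : ∀ i j, ∑ k, u k i * u k j = if i = j then 1 else 0 := fun i j => by
    simp only [hu.row_mul]
    split_ifs with h
    · simp [hu.col_sum]
    · simp
  have antipode' : ∀ i j, ∑ k, u i k * u j k = if i = j then 1 else 0 := fun i j => by
    simp only [hu.col_mul]
    split_ifs with h
    · simp [hu.row_sum]
    · simp
  refine ⟨⟨Δ, ε, S, fun a => DFunLike.congr_fun coassoc a, fun a => DFunLike.congr_fun counit_comul a,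
    fun a => DFunLike.congr_fun comul_counit a,
    ⟨StarAlgebra.adjoin ℂ G, hgen, ?_, ?_⟩, ?_⟩, hu, hΔ, hε, hS⟩
  · refine hind (fun i j => ?_) (fun c => ?_) (fun a b ha hb => ?_) (fun a b ha hb => ?_)
    · rw [hS]; exact hmemG j i
    · rw [AlgHomClass.commutes]; exact (StarAlgebra.adjoin ℂ G).algebraMap_mem c
    · rw [map_add]; exact add_mem ha hb
    · rw [map_mul]; exact mul_mem hb ha
  · refine hind (P := AntipodeAt Δ ε S (StarAlgebra.adjoin ℂ G)) (fun i j => ?_)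
      (fun c => .of_algebraMap c) (fun a b ha hb => ha.add hb) (fun a b ha hb => ha.mul hb)
    refine .of_fintype (u i) (fun k => u k j) (fun k => ⟨hmemG _ _, hmemG _ _⟩) (hΔ i j) ?_ ?_
    · simp only [hS, MulOpposite.unop_op, hε, antipode]
      split_ifs <;> simp
    · simp only [hS, MulOpposite.unop_op, hε, antipode']
      split_ifs <;> simp
  -- As a self-map of `A` the antipode is antimultiplicative, so `S² = id` is proved by comparing
  -- continuous functions on the dense subalgebra.
  · have hcont : Continuous fun a => MulOpposite.unop (S a) :=
      MulOpposite.continuous_unop.comp S.continuous_of_cstarAlgebra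
    refine congrFun (Continuous.ext_on hgen (hcont.comp hcont) continuous_id ?_)
    refine hind (fun i j => ?_) (fun c => ?_) (fun a b ha hb => ?_) (fun a b ha hb => ?_)
    · simp [hS]
    · simp [AlgHomClass.commutes]
    · beta_reduce at ha hb
      simp [ha, hb]
    · beta_reduce at ha hb
      simp [ha, hb]

end HopfCStarStructure

theorem UniversalCStarAlgebra.starAlgHom_ext {I B : Type*} [CStarAlgebra B]
    {rel : FreeStarAlgebra I → FreeStarAlgebra I → Prop} (h : CStarSeminorm.Bounded rel)
    {f g : UniversalCStarAlgebra rel h →⋆ₐ[ℂ] B} (hfg : ∀ i, f (gen h i) = g (gen h i)) :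
    f = g := by
  refine DFunLike.coe_injective (Continuous.ext_on (denseRange_ofFree h)
    f.continuous_of_cstarAlgebra g.continuous_of_cstarAlgebra ?_)
  rintro _ ⟨a, rfl⟩
  induction a using FreeStarAlgebra.induction with
  | algebraMap r => simp only [AlgHomClass.commutes]
  | gen i => exact hfg i
  | genStar i =>
    rw [← FreeStarAlgebra.star_gen, map_star, map_star, map_star]
    exact congrArg star (hfg i)
  | mul a b ha hb => simp only [map_mul, ha, hb]
  | add a b ha hb => simp only [map_add, ha, hb]

/-! ## The universal property of `A(X)` -/

namespace SimpleGraph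

variable {V B : Type*} [Fintype V] [Ring B]

open scoped Classical in
/-- The matrix `w` commutes with the adjacency matrix of `X`. -/
def AdjCommute (X : SimpleGraph V) (w : Matrix V V B) : Prop :=
  Commute (X.adjMatrix B) w

theorem adjCommute_iff {X : SimpleGraph V} [DecidableRel X.Adj] {w : Matrix V V B} :
    X.AdjCommute w ↔ ∀ i j, (∑ k, if X.Adj i k then w k j else 0) =
      ∑ k, if X.Adj k j then w i k else 0 := by
  simp only [AdjCommute, commute_iff_eq, ← Matrix.ext_iff, Matrix.mul_apply, adjMatrix_apply,
    ite_mul, mul_ite, one_mul, zero_mul, mul_one, mul_zero]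

theorem adjCommute_one (X : SimpleGraph V) [DecidableEq V] : X.AdjCommute (1 : Matrix V V B) :=
  Commute.one_right _

theorem AdjCommute.mul {X : SimpleGraph V} {v w : Matrix V V B} (hv : X.AdjCommute v)
    (hw : X.AdjCommute w) : X.AdjCommute (v * w) :=
  Commute.mul_right hv hw

theorem AdjCommute.map {X : SimpleGraph V} {C : Type*} [Ring C] {w : Matrix V V B}
    (hw : X.AdjCommute w) (f : B →+* C) : X.AdjCommute (w.map f) := by
  classical
  rw [adjCommute_iff] at hw ⊢
  intro i j
  simpa [apply_ite f] using congrArg f (hw i j)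

theorem AdjCommute.op_transpose {X : SimpleGraph V} {w : Matrix V V B} (hw : X.AdjCommute w) :
    X.AdjCommute (Matrix.of fun i j => MulOpposite.op (w j i)) := by
  classical
  rw [adjCommute_iff] at hw ⊢
  intro i j
  have h := congrArg MulOpposite.op (hw j i)
  simp only [Finset.op_sum, apply_ite MulOpposite.op, MulOpposite.op_zero] at h
  simpa [X.adj_comm] using h.symm

end SimpleGraph

namespace QuantumAutomorphismAlgebra

variable {V : Type*} [Fintype V] (X : SimpleGraph V)

/-- The image of a `*`-polynomial in `A(X)`. -/
def ofFree : FreeStarAlgebra (V × V) →⋆ₐ[ℂ] QuantumAutomorphismAlgebra X :=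
  UniversalCStarAlgebra.ofFree (QuantumAutomorphism.bounded X)

theorem ofFree_genMatrix (i j : V) :
    ofFree X (QuantumAutomorphism.genMatrix V i j) = magic X i j := rfl

theorem ofFree_eq {p q : FreeStarAlgebra (V × V)} (h : QuantumAutomorphism.Rel X p q) :
    ofFree X p = ofFree X q :=
  UniversalCStarAlgebra.ofFree_eq (QuantumAutomorphism.bounded X) h

theorem isMagicUnitary_magic : IsMagicUnitary (magic X) where
  isStarProjection i j := by
    constructor
    · change _ * _ = _
      simpa only [map_mul, ofFree_genMatrix] using ofFree_eq X (.idem i j)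
    · change star _ = _
      simpa only [map_star, ofFree_genMatrix] using ofFree_eq X (.star i j)
  row_orthogonal i j k h := by
    simpa only [map_mul, map_zero, ofFree_genMatrix] using ofFree_eq X (.row_orthogonal i j k h)
  col_orthogonal i j k h := by
    simpa only [map_mul, map_zero, ofFree_genMatrix] using ofFree_eq X (.col_orthogonal i j k h)
  row_sum i := by
    simpa only [map_sum, map_one, ofFree_genMatrix] using ofFree_eq X (.row_sum i)
  col_sum i := by
    simpa only [map_sum, map_one, ofFree_genMatrix] using ofFree_eq X (.col_sum i)

theorem adjCommute_magic : X.AdjCommute (magic X) := by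
  classical
  rw [SimpleGraph.adjCommute_iff]
  intro i j
  have h := ofFree_eq X (.adj i j)
  simp only [Matrix.mul_apply, SimpleGraph.adjMatrix_apply, ite_mul, mul_ite, one_mul, zero_mul,
    mul_one, mul_zero, map_sum, apply_ite (ofFree X), map_zero, ofFree_genMatrix] at h
  convert h using 1

theorem starAlgHom_ext {B : Type*} [CStarAlgebra B] {f g : QuantumAutomorphismAlgebra X →⋆ₐ[ℂ] B}
    (h : ∀ i j, f (magic X i j) = g (magic X i j)) : f = g :=
  UniversalCStarAlgebra.starAlgHom_ext (QuantumAutomorphism.bounded X) fun p => h p.1 p.2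

theorem generates_magic : (magic X).Generates := by
  have hdense : DenseRange (ofFree X) :=
    UniversalCStarAlgebra.denseRange_ofFree (QuantumAutomorphism.bounded X)
  refine hdense.mono ?_
  rintro _ ⟨a, rfl⟩
  rw [SetLike.mem_coe]
  have hgen (p : V × V) : ofFree X (FreeStarAlgebra.gen p) ∈
      StarAlgebra.adjoin ℂ (Set.range fun p : V × V => magic X p.1 p.2) :=
    StarAlgebra.subset_adjoin ℂ _ ⟨p, rfl⟩
  induction a using FreeStarAlgebra.induction with
  | algebraMap r =>
    rw [AlgHomClass.commutes]
    exact StarSubalgebra.algebraMap_mem _ r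
  | gen i => exact hgen i
  | genStar i =>
    rw [← FreeStarAlgebra.star_gen, map_star]
    exact star_mem (hgen i)
  | mul a b ha hb => rw [map_mul]; exact mul_mem ha hb
  | add a b ha hb => rw [map_add]; exact add_mem ha hb

variable {X} {B : Type*} [CStarAlgebra B]

/-- The universal property of `A(X)`. -/
def lift (w : Matrix V V B) (hw : IsMagicUnitary w) (hX : X.AdjCommute w) :
    QuantumAutomorphismAlgebra X →⋆ₐ[ℂ] B :=
  UniversalCStarAlgebra.lift (QuantumAutomorphism.bounded X) (fun p => w p.1 p.2) fun p q h => by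
    have hg : ∀ i j, FreeStarAlgebra.lift (fun p : V × V => w p.1 p.2)
        (QuantumAutomorphism.genMatrix V i j) = w i j :=
      fun i j => FreeStarAlgebra.lift_gen _ (i, j)
    cases h with
    | star i j => rw [map_star, hg, hw.star_eq]
    | idem i j => rw [map_mul, hg, hw.mul_self]
    | row_orthogonal i j k h => rw [map_mul, hg, hg, hw.row_orthogonal i j k h, map_zero]
    | col_orthogonal i j k h => rw [map_mul, hg, hg, hw.col_orthogonal i j k h, map_zero]
    | row_sum i => simp only [map_sum, hg, hw.row_sum, map_one]
    | col_sum i => simp only [map_sum, hg, hw.col_sum, map_one]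
    | adj i j =>
      classical
      simp only [Matrix.mul_apply, SimpleGraph.adjMatrix_apply, ite_mul, mul_ite, one_mul,
        zero_mul, mul_one, mul_zero, map_sum, apply_ite (FreeStarAlgebra.lift _), map_zero, hg]
      exact SimpleGraph.adjCommute_iff.1 hX i j

@[simp] theorem lift_magic (w : Matrix V V B) (hw : IsMagicUnitary w) (hX : X.AdjCommute w)
    (i j : V) : lift w hw hX (magic X i j) = w i j :=
  UniversalCStarAlgebra.lift_gen (QuantumAutomorphism.bounded X) _ _ (i, j)

variable (X)

/-- The comultiplication of `A(X)`. -/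
def comul : QuantumAutomorphismAlgebra X →⋆ₐ[ℂ]
    MaxTensorProduct (QuantumAutomorphismAlgebra X) (QuantumAutomorphismAlgebra X) :=
  lift ((magic X).map MaxTensorProduct.inl * (magic X).map MaxTensorProduct.inr)
    (((isMagicUnitary_magic X).map _).mul ((isMagicUnitary_magic X).map _)
      fun _ _ _ _ => MaxTensorProduct.commute_inl_inr _ _)
    (((adjCommute_magic X).map (MaxTensorProduct.inl :
        QuantumAutomorphismAlgebra X →⋆ₐ[ℂ] _).toAlgHom.toRingHom).mul
      ((adjCommute_magic X).map (MaxTensorProduct.inr :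
        QuantumAutomorphismAlgebra X →⋆ₐ[ℂ] _).toAlgHom.toRingHom))

/-- The counit of `A(X)`. -/
def counit [DecidableEq V] : QuantumAutomorphismAlgebra X →⋆ₐ[ℂ] ℂ := lift 1 .one X.adjCommute_one

/-- The antipode of `A(X)`. -/
def antipode : QuantumAutomorphismAlgebra X →⋆ₐ[ℂ] (QuantumAutomorphismAlgebra X)ᵐᵒᵖ :=
  lift _ (isMagicUnitary_magic X).op_transpose (adjCommute_magic X).op_transpose

theorem comul_magic (i j : V) : comul X (magic X i j) =
    ∑ k, MaxTensorProduct.tmul (magic X i k) (magic X k j) :=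
  lift_magic _ _ _ i j

theorem counit_magic [DecidableEq V] (i j : V) : counit X (magic X i j) = if i = j then 1 else 0 :=
  lift_magic _ _ _ i j

theorem antipode_magic (i j : V) : antipode X (magic X i j) = MulOpposite.op (magic X j i) :=
  lift_magic _ _ _ i j

end QuantumAutomorphismAlgebra

/-! ## The universal property of the free wreath product -/

namespace FreeWreathProduct

variable {A B C ι κ : Type*} [CStarAlgebra A] [CStarAlgebra B] [CStarAlgebra C]
  {u : Matrix ι ι A} {v : Matrix κ κ B}

/-- The universal property of the free wreath product. -/
def lift (f : κ → A →⋆ₐ[ℂ] C) (g : B →⋆ₐ[ℂ] C)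
    (hfg : ∀ a b i j, Commute (f a (u i j)) (g (v a b))) : FreeWreathProduct u v →⋆ₐ[ℂ] C :=
  UniversalCStarAlgebra.lift (bounded u v) (Sum.elim (fun p => f p.1 p.2) g) fun p q h => by
    have hc : ∀ a x, FreeStarAlgebra.lift (Sum.elim (fun p : κ × A => f p.1 p.2) g)
        (copyGen a x) = f a x := fun a x => FreeStarAlgebra.lift_gen _ _
    have hb : ∀ y, FreeStarAlgebra.lift (Sum.elim (fun p : κ × A => f p.1 p.2) g)
        (baseGen y) = g y := fun y => FreeStarAlgebra.lift_gen _ _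
    cases h with
    | copy a _ _ h => exact StarHomRel.lift_eq (f a) (hc a) h
    | base _ _ h => exact StarHomRel.lift_eq g hb h
    | comm a b i j =>
      rw [map_mul, map_mul, hc, hb]
      exact (hfg a b i j).eq

@[simp] theorem lift_copy (f : κ → A →⋆ₐ[ℂ] C) (g : B →⋆ₐ[ℂ] C)
    (hfg : ∀ a b i j, Commute (f a (u i j)) (g (v a b))) (a : κ) (x : A) :
    lift f g hfg (copy u v a x) = f a x :=
  UniversalCStarAlgebra.lift_gen (bounded u v) _ _ (Sum.inl (a, x))

@[simp] theorem lift_base (f : κ → A →⋆ₐ[ℂ] C) (g : B →⋆ₐ[ℂ] C)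
    (hfg : ∀ a b i j, Commute (f a (u i j)) (g (v a b))) (y : B) :
    lift f g hfg (base u v y) = g y :=
  UniversalCStarAlgebra.lift_gen (bounded u v) _ _ (Sum.inr y)

/-- The generators of the universal algebra are by definition the elements of the copies of `A` and
of `B`. -/
theorem starAlgHom_ext {f g : FreeWreathProduct u v →⋆ₐ[ℂ] C}
    (hcopy : ∀ a, f.comp (copy u v a) = g.comp (copy u v a))
    (hbase : f.comp (base u v) = g.comp (base u v)) : f = g := by
  refine UniversalCStarAlgebra.starAlgHom_ext (bounded u v) ?_
  rintro (⟨a, x⟩ | y)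
  · exact DFunLike.congr_fun (hcopy a) x
  · exact DFunLike.congr_fun hbase y

theorem commute_copy_base (a b : κ) (i j : ι) :
    Commute (copy u v a (u i j)) (base u v (v a b)) := by
  have h := UniversalCStarAlgebra.ofFree_eq (bounded u v) (.comm a b i j)
  rw [map_mul, map_mul] at h
  exact h

variable [Fintype ι] [Fintype κ]

theorem isMagicUnitary_magic (hu : IsMagicUnitary u) (hv : IsMagicUnitary v) :
    IsMagicUnitary (magic u v) := by
  classical
  have hU : ∀ a, IsMagicUnitary (u.map (copy u v a)) := fun a => hu.map _
  have hV : IsMagicUnitary (v.map (base u v)) := hv.map _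
  refine ⟨fun i j => ?_, ?_, ?_, ?_, ?_⟩
  · exact ((hU _).isStarProjection _ _).mul (hV.isStarProjection _ _) (commute_copy_base _ _ _ _)
  · rintro ⟨i, a⟩ ⟨j, b⟩ ⟨k, c⟩ h
    change copy u v a (u i j) * base u v (v a b) * (copy u v a (u i k) * base u v (v a c)) = 0
    -- Writing the first factor as `v * u` and the second as `u * v` brings the two entries of `u`
    -- from the same copy together. If they are not orthogonal they are equal, and then the entries
    -- of `v` are orthogonal.
    rw [(commute_copy_base a b i j).eq, mul_assoc, ← mul_assoc (copy u v a _), ← map_mul]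
    by_cases hjk : j = k
    · subst hjk
      rw [hu.mul_self, (commute_copy_base a c i j).eq, ← mul_assoc, ← map_mul,
        hv.row_orthogonal a b c fun hbc => h (by rw [hbc]), map_zero, zero_mul]
    · rw [hu.row_orthogonal i j k hjk, map_zero, zero_mul, mul_zero]
  · rintro ⟨i, a⟩ ⟨j, b⟩ ⟨k, c⟩ h
    change copy u v b (u j i) * base u v (v b a) * (copy u v c (u k i) * base u v (v c a)) = 0
    -- Here the entries of `v` are brought together first: the two entries of `u` lie in the same
    -- copy only when `b = c`.
    rw [(commute_copy_base c a k i).eq, mul_assoc, ← mul_assoc (base u v _), ← map_mul]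
    by_cases hbc : b = c
    · subst hbc
      rw [hv.mul_self, ← (commute_copy_base b a k i).eq, ← mul_assoc, ← map_mul,
        hu.col_orthogonal i j k fun hjk => h (by rw [hjk]), map_zero, zero_mul]
    · rw [hv.col_orthogonal a b c hbc, map_zero, zero_mul, mul_zero]
  · rintro ⟨i, a⟩
    simp only [magic, Matrix.of_apply, Fintype.sum_prod_type, ← Finset.mul_sum, ← map_sum,
      hv.row_sum, map_one, mul_one, hu.row_sum]
  · rintro ⟨i, a⟩
    simp only [magic, Matrix.of_apply, Fintype.sum_prod_type_right, ← Finset.sum_mul, ← map_sum,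
      hu.col_sum, map_one, one_mul, hv.col_sum]

end FreeWreathProduct

/-! ## Magic unitaries commuting with the pentagon -/

/-- A magic unitary over `ℤ/5` commuting with the adjacency matrix of the pentagon. -/
structure IsPentagonMagic {A : Type*} [Ring A] [StarRing A] (V : Matrix (ZMod 5) (ZMod 5) A) :
    Prop extends IsMagicUnitary V where
  adj : ∀ a b, V (a + 1) b + V (a - 1) b = V a (b + 1) + V a (b - 1)

namespace IsPentagonMagic

variable {A : Type*} [Ring A] [StarRing A] {V : Matrix (ZMod 5) (ZMod 5) A}

/-- Reversing the columns of a magic unitary of the pentagon. -/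
theorem neg_col (hV : IsPentagonMagic V) : IsPentagonMagic (Matrix.of fun a b => V a (-b)) where
  isStarProjection a b := hV.isStarProjection a (-b)
  row_orthogonal a b c h := hV.row_orthogonal a _ _ fun hbc => h (neg_injective hbc)
  col_orthogonal a b c h := hV.col_orthogonal _ b c h
  row_sum a := (Equiv.sum_comp (Equiv.neg (ZMod 5)) fun b => V a b).trans (hV.row_sum a)
  col_sum a := hV.col_sum _
  adj a b := by
    simp only [Matrix.of_apply, neg_add_rev, neg_sub]
    rw [hV.adj, add_comm, sub_eq_add_neg, sub_eq_add_neg, add_comm (-1) (-b), add_comm 1 (-b)]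

/-- Multiply the adjacency relation at `(a + 1, b)` by `V a b`. On its left side only `V a b`
survives, because `a + 2 ≠ a`. -/
theorem eq_add (hV : IsPentagonMagic V) (a b : ZMod 5) :
    V a b = V a b * V (a + 1) (b + 1) + V a b * V (a + 1) (b - 1) := by
  have h := congrArg (V a b * ·) (hV.adj (a + 1) b)
  simp only [mul_add, hV.col_mul, add_sub_cancel_right, if_true] at h
  rw [if_neg (by clear * -; decide +revert), zero_add] at h
  exact h

/-- Given that `b` goes to `a`, the vertex `b + 1` goes to `a + 1` if and only if `b - 1` goes
to `a - 1`. -/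
theorem mul_add_one (hV : IsPentagonMagic V) (a b : ZMod 5) :
    V a b * V (a + 1) (b + 1) = V a b * V (a - 1) (b - 1) := by
  have h1 := hV.eq_add a b
  -- The relation at `(a, b - 1)` gives a second decomposition of `V a b`; it shares one term with
  -- `eq_add`, and cancelling that term leaves the claim.
  have h2 : V a b * V (a + 1) (b - 1) + V a b * V (a - 1) (b - 1) = V a b := by
    have h := congrArg (V a b * ·) (hV.adj a (b - 1))
    simp only [mul_add, hV.row_mul, sub_add_cancel, if_true] at h
    rwa [if_neg (by clear * -; decide +revert), add_zero] at h
  rw [add_comm] at h2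
  exact add_right_cancel (h1.symm.trans h2.symm)

/-- This is `mul_add_one` after reversing the columns. -/
theorem mul_sub_one (hV : IsPentagonMagic V) (a b : ZMod 5) :
    V a b * V (a + 1) (b - 1) = V a b * V (a - 1) (b + 1) := by
  have h := hV.neg_col.mul_add_one a (-b)
  simpa [sub_eq_add_neg, add_comm] using h

theorem mul_sub_one' (hV : IsPentagonMagic V) (a b : ZMod 5) :
    V (a + 1) (b - 1) * V a b = V (a - 1) (b + 1) * V a b := by
  simpa [hV.star_eq] using congrArg star (hV.mul_sub_one a b)

/-- The heart of the absence of quantum symmetry. Put `p = V a b` and `q = V (a + 1) (b + 1)`. The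
relation splits `q` as `q * p + q * V a (b + 2)`, and `p * q * V a (b + 2) = 0`. Hence `p * q = p *
q * p` is self-adjoint, which means that `p` and `q` commute. -/
theorem commute_add_one (hV : IsPentagonMagic V) (a b : ZMod 5) :
    Commute (V a b) (V (a + 1) (b + 1)) := by
  -- If `b, b + 1, b + 2` went to `a, a + 1, a`, then both `b - 1` and `b + 3` would go to `a - 1`;
  -- these differ mod 5. Doubling the middle projection lets each half be replaced separately.
  have h0 : V a b * V (a + 1) (b + 1) * V a (b + 2) = 0 := by
    have h := hV.mul_sub_one' a (b + 2)
    rw [show b + 2 - 1 = b + 1 by ring, show b + 2 + 1 = b + 3 by ring] at h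
    calc V a b * V (a + 1) (b + 1) * V a (b + 2)
        = V a b * V (a + 1) (b + 1) * (V (a + 1) (b + 1) * V a (b + 2)) := by
          rw [← mul_assoc _ (V (a + 1) (b + 1)) (V a (b + 2)),
            mul_assoc (V a b) (V (a + 1) (b + 1)) (V (a + 1) (b + 1)), hV.mul_self]
      _ = V a b * (V (a - 1) (b - 1) * V (a - 1) (b + 3)) * V a (b + 2) := by
          rw [h, hV.mul_add_one]; simp only [mul_assoc]
      _ = 0 := by
          rw [hV.row_orthogonal _ _ _ (by clear * -; decide +revert), mul_zero, zero_mul]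
  have h1 : V (a + 1) (b + 1) = V (a + 1) (b + 1) * V a b + V (a + 1) (b + 1) * V a (b + 2) := by
    have h := congrArg (V (a + 1) (b + 1) * ·) (hV.adj a (b + 1))
    simp only [mul_add, hV.col_mul, if_true, add_sub_cancel_right] at h
    rw [if_neg (by clear * -; decide +revert), add_zero, add_assoc b, one_add_one_eq_two] at h
    rw [add_comm (V (a + 1) (b + 1) * V a b)]
    exact h
  have h2 : V a b * V (a + 1) (b + 1) = V a b * V (a + 1) (b + 1) * V a b := by
    conv_lhs => rw [h1, mul_add, ← mul_assoc, ← mul_assoc, h0, add_zero]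
  have h3 := congrArg star h2
  simp only [star_mul, hV.star_eq, ← mul_assoc] at h3
  exact h2.trans h3.symm

/-- The projection corresponding to the rotation `x ↦ x + k`. -/
def rot (V : Matrix (ZMod 5) (ZMod 5) A) (k : ZMod 5) : A := V k 0 * V (k + 1) 1

/-- The projection corresponding to the reflection `x ↦ k - x`. -/
def refl (V : Matrix (ZMod 5) (ZMod 5) A) (k : ZMod 5) : A := V k 0 * V (k + 1) (-1)

theorem refl_eq {A : Type*} [Ring A] (V : Matrix (ZMod 5) (ZMod 5) A) (k : ZMod 5) :
    refl V k = rot (Matrix.of fun a b => V a (-b)) k := by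
  simp [refl, rot]

/-- By `mul_add_one`, the product of the entries at `b + 1` and `b + 2` equals that at `b + 1` and
`b`, and these two commute. So the product does not change along the diagonal. -/
theorem mul_add_one_eq_rot (hV : IsPentagonMagic V) (k b : ZMod 5) :
    V (k + b) b * V (k + b + 1) (b + 1) = rot V k := by
  have step : ∀ b, V (k + (b + 1)) (b + 1) * V (k + (b + 1) + 1) (b + 1 + 1) =
      V (k + b) b * V (k + b + 1) (b + 1) := fun b => by
    rw [hV.mul_add_one, ← add_assoc, add_sub_cancel_right, add_sub_cancel_right,
      (hV.commute_add_one (k + b) b).eq]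
  have hn : ∀ n : ℕ, V (k + n) n * V (k + n + 1) (n + 1) = rot V k := fun n => by
    induction n with
    | zero => simp [rot]
    | succ n ih => rw [← ih, ← step n]; push_cast; rfl
  simpa using hn b.val

theorem rot_isStarProjection (hV : IsPentagonMagic V) (k : ZMod 5) :
    IsStarProjection (rot V k) := by
  refine (hV.isStarProjection _ _).mul (hV.isStarProjection _ _) ?_
  simpa using hV.commute_add_one k 0

/-- Since `rot V k` can be computed at any `b`, it lies below every entry of the `k`-th diagonal.
This makes projections of different permutations orthogonal. -/
theorem rot_mul (hV : IsPentagonMagic V) (k b : ZMod 5) : rot V k * V (k + b) b = rot V k := by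
  rw [← hV.mul_add_one_eq_rot k b, (hV.commute_add_one (k + b) b).eq, mul_assoc, hV.mul_self]

theorem mul_rot (hV : IsPentagonMagic V) (k b : ZMod 5) : V (k + b) b * rot V k = rot V k := by
  rw [← hV.mul_add_one_eq_rot k b, ← mul_assoc, hV.mul_self]

theorem refl_isStarProjection (hV : IsPentagonMagic V) (k : ZMod 5) :
    IsStarProjection (refl V k) := by
  rw [refl_eq]; exact hV.neg_col.rot_isStarProjection k

theorem refl_mul (hV : IsPentagonMagic V) (k b : ZMod 5) : refl V k * V (k - b) b = refl V k := by
  simpa [← refl_eq, sub_eq_add_neg] using hV.neg_col.rot_mul k (-b)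

theorem mul_refl (hV : IsPentagonMagic V) (k b : ZMod 5) : V (k - b) b * refl V k = refl V k := by
  simpa [← refl_eq, sub_eq_add_neg] using hV.neg_col.mul_rot k (-b)

/-- These are the two terms of `eq_add`: the first lies on the rotation diagonal `a - b`, the second
on the reflection diagonal `a + b`. -/
theorem eq_rot_add_refl (hV : IsPentagonMagic V) (a b : ZMod 5) :
    V a b = rot V (a - b) + refl V (a + b) := by
  have h1 := hV.mul_add_one_eq_rot (a - b) b
  have h2 := hV.neg_col.mul_add_one_eq_rot (a + b) (-b)
  rw [sub_add_cancel] at h1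
  rw [← refl_eq, add_neg_cancel_right] at h2
  simp only [Matrix.of_apply, neg_neg, neg_add, ← sub_eq_add_neg] at h2
  rw [← h1, ← h2]
  exact hV.eq_add a b

/-- The projection corresponding to an element of the dihedral group. -/
def proj (V : Matrix (ZMod 5) (ZMod 5) A) : DihedralGroup 5 → A
  | .r k => rot V k
  -- The reflection `sr k` is `x ↦ -k - x`.
  | .sr k => refl V (-k)

theorem proj_isStarProjection (hV : IsPentagonMagic V) (σ : DihedralGroup 5) :
    IsStarProjection (proj V σ) := by
  cases σ
  exacts [hV.rot_isStarProjection _, hV.refl_isStarProjection _]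

theorem proj_mul (hV : IsPentagonMagic V) (σ : DihedralGroup 5) (b : ZMod 5) :
    proj V σ * V (dihedralPerm 5 σ b) b = proj V σ := by
  cases σ with
  | r k => simpa [dihedralPerm, proj, add_comm] using hV.rot_mul k b
  | sr k => simpa [dihedralPerm, proj, sub_eq_add_neg, add_comm] using hV.refl_mul (-k) b

theorem mul_proj (hV : IsPentagonMagic V) (σ : DihedralGroup 5) (b : ZMod 5) :
    V (dihedralPerm 5 σ b) b * proj V σ = proj V σ := by
  cases σ with
  | r k => simpa [dihedralPerm, proj, add_comm] using hV.mul_rot k b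
  | sr k => simpa [dihedralPerm, proj, sub_eq_add_neg, add_comm] using hV.mul_refl (-k) b

theorem _root_.exists_dihedralPerm_five_ne {σ τ : DihedralGroup 5} (h : σ ≠ τ) :
    ∃ b, dihedralPerm 5 σ b ≠ dihedralPerm 5 τ b := by
  rcases σ with i | i <;> rcases τ with j | j
  · refine ⟨0, ?_⟩
    rintro h'
    simp [dihedralPerm] at h'
    exact h (by rw [h'])
  · change ∃ b : ZMod 5, b + i ≠ -(b + j)
    revert i j; decide
  · change ∃ b : ZMod 5, -(b + i) ≠ b + j
    revert i j; decide
  · refine ⟨0, ?_⟩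
    rintro h'
    simp [dihedralPerm] at h'
    exact h (by rw [h'])

/-- Choose `b` where `σ` and `τ` differ; the two projections lie below orthogonal entries of column
`b`. -/
theorem proj_orthogonal (hV : IsPentagonMagic V) (σ τ : DihedralGroup 5) (h : σ ≠ τ) :
    proj V σ * proj V τ = 0 := by
  obtain ⟨b, hb⟩ := exists_dihedralPerm_five_ne h
  rw [← hV.proj_mul σ b, ← hV.mul_proj τ b, mul_assoc, ← mul_assoc (V _ b),
    hV.col_orthogonal _ _ _ hb, zero_mul, mul_zero]

theorem _root_.DihedralGroup.sum_eq {n : ℕ} [NeZero n] {M : Type*} [AddCommMonoid M]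
    (f : DihedralGroup n → M) :
    ∑ σ, f σ = ∑ k, f (.r k) + ∑ k, f (.sr k) := by
  let e : ZMod n ⊕ ZMod n ≃ DihedralGroup n :=
    { toFun := Sum.elim .r .sr
      invFun := fun σ => match σ with
        | .r k => .inl k
        | .sr k => .inr k
      left_inv := by rintro (k | k) <;> rfl
      right_inv := by rintro (k | k) <;> rfl }
  rw [← e.sum_comp, Fintype.sum_sum_type]
  rfl

theorem sum_ite_proj (hV : IsPentagonMagic V) (a b : ZMod 5) :
    (∑ σ, if dihedralPerm 5 σ b = a then proj V σ else 0) = V a b := by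
  rw [DihedralGroup.sum_eq, hV.eq_rot_add_refl a b]
  have h1 : ∀ k, dihedralPerm 5 (.r k) b = a ↔ k = a - b := fun k => by
    rw [eq_sub_iff_add_eq, add_comm k]; rfl
  have h2 : ∀ k, dihedralPerm 5 (.sr k) b = a ↔ k = -(a + b) := fun k => by
    change -(b + k) = a ↔ _
    grind
  simp [h1, h2, proj]

/-- Expand `∑ a, V a 0 = 1`: each `σ` occurs exactly once, at `a = σ 0`. -/
theorem sum_proj (hV : IsPentagonMagic V) : ∑ σ, proj V σ = 1 := by
  rw [← hV.col_sum 0, ← Finset.sum_congr rfl fun a _ => hV.sum_ite_proj a 0, Finset.sum_comm]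
  simp

end IsPentagonMagic

variable {A : Type*} [CStarAlgebra A]

/-- The pentagon has no quantum symmetry: its magic unitaries come from `C(D₅)`. -/
def IsPentagonMagic.hom {V : Matrix (ZMod 5) (ZMod 5) A} (hV : IsPentagonMagic V) :
    (DihedralGroup 5 → ℂ) →⋆ₐ[ℂ] A :=
  .ofPartition (IsPentagonMagic.proj V) hV.proj_isStarProjection hV.proj_orthogonal hV.sum_proj

theorem IsPentagonMagic.hom_permutationMagic {V : Matrix (ZMod 5) (ZMod 5) A}
    (hV : IsPentagonMagic V) (a b : ZMod 5) :
    hV.hom (permutationMagic (dihedralPerm 5) a b) = V a b := by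
  rw [hom, StarAlgHom.ofPartition_apply, ← hV.sum_ite_proj a b]
  simp [permutationMagic]

theorem isPentagonMagic_permutationMagic :
    IsPentagonMagic (permutationMagic (dihedralPerm 5)) where
  toIsMagicUnitary := isMagicUnitary_permutationMagic _
  adj a b := by
    ext σ
    simp only [permutationMagic, Pi.add_apply, Matrix.of_apply]
    cases σ with
    | r k =>
      change (if b + k = a + 1 then (1 : ℂ) else 0) + (if b + k = a - 1 then 1 else 0) =
        (if b + 1 + k = a then 1 else 0) + if b - 1 + k = a then 1 else 0
      -- A rotation matches `a + 1` with `b - 1`, whereas a reflection matches it with `b + 1`;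
      -- hence the swap in this case only.
      rw [add_comm]
      congr 1 <;> exact if_congr (by grind) rfl rfl
    | sr k =>
      change (if -(b + k) = a + 1 then (1 : ℂ) else 0) + (if -(b + k) = a - 1 then 1 else 0) =
        (if -(b + 1 + k) = a then 1 else 0) + if -(b - 1 + k) = a then 1 else 0
      congr 1 <;> exact if_congr (by grind) rfl rfl

theorem IsPentagonMagic.map {B : Type*} [CStarAlgebra B] {V : Matrix (ZMod 5) (ZMod 5) A}
    (hV : IsPentagonMagic V) (f : A →⋆ₐ[ℂ] B) : IsPentagonMagic (V.map f) where
  toIsMagicUnitary := hV.toIsMagicUnitary.map f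
  adj a b := by simp [← map_add, hV.adj]

/-- An element of `D₅` is determined by the images of the adjacent vertices `0` and `1`, so each
point indicator is a product of two entries. -/
theorem dihedralGroup_starAlgHom_ext {f g : (DihedralGroup 5 → ℂ) →⋆ₐ[ℂ] A}
    (h : ∀ a b, f (permutationMagic (dihedralPerm 5) a b) =
      g (permutationMagic (dihedralPerm 5) a b)) : f = g := by
  refine StarAlgHom.pi_ext fun σ => ?_
  have hσ : Pi.single σ 1 = permutationMagic (dihedralPerm 5) (dihedralPerm 5 σ 0) 0 *
      permutationMagic (dihedralPerm 5) (dihedralPerm 5 σ 1) 1 := by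
    ext τ
    simp only [permutationMagic, Matrix.of_apply, Pi.mul_apply, Pi.single_apply, mul_ite,
      mul_one, mul_zero]
    by_cases hτ : τ = σ
    · simp [hτ]
    · rw [if_neg hτ]
      have : ¬ (dihedralPerm 5 τ 1 = dihedralPerm 5 σ 1 ∧
          dihedralPerm 5 τ 0 = dihedralPerm 5 σ 0) := by
        revert σ τ
        decide
      split_ifs <;> simp_all
  rw [hσ, map_mul, map_mul, h, h]

/-! ## Magic unitaries of size two -/

/-- Magic unitaries over `ℤ/2` come from `C(ℤ/2)`. -/
def IsMagicUnitary.homTwo {U : Matrix (ZMod 2) (ZMod 2) A} (hU : IsMagicUnitary U) :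
    (Multiplicative (ZMod 2) → ℂ) →⋆ₐ[ℂ] A :=
  .ofPartition (fun g : Multiplicative (ZMod 2) => U g.toAdd 0)
    (fun _ => hU.isStarProjection _ _)
    (fun _ _ h => hU.col_orthogonal _ _ _ h) (by exact hU.col_sum 0)

theorem IsMagicUnitary.homTwo_permutationMagic {U : Matrix (ZMod 2) (ZMod 2) A}
    (hU : IsMagicUnitary U) (i j : ZMod 2) :
    hU.homTwo (permutationMagic (cyclicPerm 2) i j) = U i j := by
  have h1 : hU.homTwo (permutationMagic (cyclicPerm 2) i j) = U (i - j) 0 := by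
    refine (StarAlgHom.ofPartition_apply _ _ _ _ _).trans ?_
    have h : ∀ k : Multiplicative (ZMod 2), cyclicPerm 2 k j = i ↔ k = .ofAdd (i - j) := fun k => by
      change k.toAdd + j = i ↔ k.toAdd = i - j
      rw [eq_sub_iff_add_eq]
    simp [permutationMagic, h]
  rw [h1]
  -- The row and column sums force `U` to be circulant, so its column `0` determines it.
  have hr : ∀ i, U i 0 + U i 1 = 1 := fun i => (Fin.sum_univ_two (U i)).symm.trans (hU.row_sum i)
  have hc : ∀ i, U 0 i + U 1 i = 1 := fun i => (Fin.sum_univ_two fun j => U j i).symm.trans (hU.col_sum i)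
  have h01 : U 1 0 = U 0 1 := by
    have := (hr 0).trans (hc 0).symm
    exact (add_left_cancel this).symm
  have h11 : U 1 1 = U 0 0 := by
    have := (hr 0).trans (hr 1).symm
    rw [add_comm (U 1 0), h01] at this
    exact (add_right_cancel this).symm
  fin_cases i <;> fin_cases j
  · rfl
  · exact h01
  · rfl
  · exact h11.symm

theorem cyclicTwo_starAlgHom_ext {f g : (Multiplicative (ZMod 2) → ℂ) →⋆ₐ[ℂ] A}
    (h : ∀ i j, f (permutationMagic (cyclicPerm 2) i j) =
      g (permutationMagic (cyclicPerm 2) i j)) : f = g := by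
  refine StarAlgHom.pi_ext fun k => ?_
  have hk : Pi.single k 1 = permutationMagic (cyclicPerm 2) k.toAdd 0 := by
    ext l
    simp only [permutationMagic, Matrix.of_apply, Pi.single_apply]
    refine if_congr ?_ rfl rfl
    change _ ↔ l.toAdd + 0 = k.toAdd
    rw [add_zero]; rfl
  rw [hk, h]

/-! ## The graph `C₁₀(4)` as a blow-up of the pentagon -/

/-- The isomorphism `ℤ/2 × ℤ/5 ≃ ℤ/10`. -/
def zmodTenEquiv : ZMod 2 × ZMod 5 ≃ ZMod 10 where
  toFun p := 5 * p.1.val + 6 * p.2.val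
  invFun x := (x.val, x.val)
  left_inv := by decide
  right_inv := by decide

/-- `zmodTenEquiv` uses the idempotents `5 ↔ (1, 0)` and `6 ↔ (0, 1)` of `ℤ/10`. The differences
`±1` are odd and `±4` even, and both pairs reduce to `±1` mod 5; so the parity is free. -/
theorem cycleWithChords_adj_iff (p q : ZMod 2 × ZMod 5) :
    (cycleWithChords 10 {4}).Adj (zmodTenEquiv p) (zmodTenEquiv q) ↔
      q.2 = p.2 + 1 ∨ q.2 = p.2 - 1 := by
  simp only [cycleWithChords, SimpleGraph.circulantGraph_adj, Set.image_singleton,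
    Set.mem_insert_iff, Set.mem_singleton_iff, zmodTenEquiv, Equiv.coe_fn_mk]
  decide +revert

theorem sum_ite_pentagon {M : Type*} [AddCommMonoid M] (f : ZMod 5 → M) (a : ZMod 5) :
    (∑ b, if b = a + 1 ∨ b = a - 1 then f b else 0) = f (a + 1) + f (a - 1) := by
  have h : ∀ b, (if b = a + 1 ∨ b = a - 1 then f b else 0) =
      (if b = a + 1 then f b else 0) + if b = a - 1 then f b else 0 := fun b => by
    have hne : a + 1 ≠ a - 1 := by clear * -; decide +revert
    by_cases h1 : b = a + 1
    · subst h1; simp [hne]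
    · simp [h1]
  simp [h, Finset.sum_add_distrib]

/-- A magic unitary over `ℤ/2 × ℤ/5` commuting with the adjacency matrix of the pentagon with
doubled vertices. -/
structure IsDoublePentagonMagic {A : Type*} [Ring A] [StarRing A]
    (M : Matrix (ZMod 2 × ZMod 5) (ZMod 2 × ZMod 5) A) : Prop extends IsMagicUnitary M where
  adj : ∀ i a j b, ∑ k, M (k, a + 1) (j, b) + ∑ k, M (k, a - 1) (j, b) =
    ∑ k, M (i, a) (k, b + 1) + ∑ k, M (i, a) (k, b - 1)

theorem adjCommute_cycleWithChords_iff {A : Type*} [Ring A] {w : Matrix (ZMod 10) (ZMod 10) A} :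
    (cycleWithChords 10 {4}).AdjCommute w ↔ ∀ i a j b,
      ∑ k, w (zmodTenEquiv (k, a + 1)) (zmodTenEquiv (j, b)) +
        ∑ k, w (zmodTenEquiv (k, a - 1)) (zmodTenEquiv (j, b)) =
      ∑ k, w (zmodTenEquiv (i, a)) (zmodTenEquiv (k, b + 1)) +
        ∑ k, w (zmodTenEquiv (i, a)) (zmodTenEquiv (k, b - 1)) := by
  classical
  have hsum (f : ZMod 10 → A) (i : ZMod 2) (a : ZMod 5) :
      (∑ x, if (cycleWithChords 10 {4}).Adj (zmodTenEquiv (i, a)) x then f x else 0) =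
        ∑ k, f (zmodTenEquiv (k, a + 1)) + ∑ k, f (zmodTenEquiv (k, a - 1)) := by
    rw [← zmodTenEquiv.sum_comp]
    simp only [cycleWithChords_adj_iff, Fintype.sum_prod_type, sum_ite_pentagon,
      Finset.sum_add_distrib]
  rw [SimpleGraph.adjCommute_iff]
  constructor
  · intro h i a j b
    have := h (zmodTenEquiv (i, a)) (zmodTenEquiv (j, b))
    simp only [SimpleGraph.adj_comm _ _ (zmodTenEquiv (j, b))] at this
    rwa [hsum, hsum] at this
  · intro h x y
    obtain ⟨⟨i, a⟩, rfl⟩ := zmodTenEquiv.surjective x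
    obtain ⟨⟨j, b⟩, rfl⟩ := zmodTenEquiv.surjective y
    simp only [SimpleGraph.adj_comm _ _ (zmodTenEquiv (j, b))]
    rw [hsum, hsum]
    exact h i a j b

/-- The hypothesis gives `D (a + 2) = -D a`. Five such steps return to `a` with sign `-1`, so `2 D a
= 0`. -/
theorem pentagon_kernel {A : Type*} [CStarAlgebra A] {D : ZMod 5 → A}
    (h : ∀ a, D (a + 1) + D (a - 1) = 0) (a : ZMod 5) : D a = 0 := by
  have h2 : ∀ a, D (a + 2) = - D a := fun a => by
    have := h (a + 1)
    rw [add_sub_cancel_right, add_assoc, one_add_one_eq_two] at this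
    exact eq_neg_of_add_eq_zero_left this
  have h10 : D a = - D a := by
    conv_lhs => rw [show a = a + 2 + 2 + 2 + 2 + 2 by clear * -; decide +revert]
    simp only [h2, neg_neg]
  have : (2 : ℂ) • D a = 0 := by
    rw [two_smul]; nth_rewrite 2 [h10]; exact add_neg_cancel _
  simpa using this

/-! ### Factorisation into a quotient over the pentagon and fibres of size two -/

namespace IsDoublePentagonMagic

variable {A : Type*} [CStarAlgebra A] {M : Matrix (ZMod 2 × ZMod 5) (ZMod 2 × ZMod 5) A}

/-- The quotient magic unitary over the vertices of the pentagon. -/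
def block (M : Matrix (ZMod 2 × ZMod 5) (ZMod 2 × ZMod 5) A) : Matrix (ZMod 5) (ZMod 5) A :=
  Matrix.of fun a b => ∑ k, M (0, a) (k, b)

/-- The magic unitary over the fibre of the vertex `a`. -/
def fibre (M : Matrix (ZMod 2 × ZMod 5) (ZMod 2 × ZMod 5) A) (a : ZMod 5) :
    Matrix (ZMod 2) (ZMod 2) A :=
  Matrix.of fun i j => ∑ b, M (i, a) (j, b)

theorem sum_col_eq_sum_row (hM : IsDoublePentagonMagic M) (i j : ZMod 2) (a b : ZMod 5) :
    ∑ k, M (k, a) (j, b) = ∑ k, M (i, a) (k, b) := by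
  -- The right side of the adjacency relation does not involve `j`, so the differences of column
  -- sums lie in the kernel of the pentagon. For `hrow` the roles of rows and columns are exchanged.
  have hcol : ∀ j', ∑ k, M (k, a) (j', b) = ∑ k, M (k, a) (j, b) := fun j' => by
    refine sub_eq_zero.1 (pentagon_kernel
      (D := fun a => ∑ k, M (k, a) (j', b) - ∑ k, M (k, a) (j, b)) (fun a => ?_) a)
    have h := (hM.adj i a j' b).trans (hM.adj i a j b).symm
    rw [← sub_eq_zero] at h
    rw [← h]
    abel
  have hrow : ∀ i', ∑ k, M (i', a) (k, b) = ∑ k, M (i, a) (k, b) := fun i' => by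
    refine sub_eq_zero.1 (pentagon_kernel
      (D := fun b => ∑ k, M (i', a) (k, b) - ∑ k, M (i, a) (k, b)) (fun b => ?_) b)
    have h := (hM.adj i' a j b).symm.trans (hM.adj i a j b)
    rw [← sub_eq_zero] at h
    rw [← h]
    abel
  -- The total of the `2 × 2` block is twice a column sum and also twice a row sum.
  have h2 : ∑ j' : ZMod 2, ∑ k, M (k, a) (j', b) = ∑ i' : ZMod 2, ∑ k, M (i', a) (k, b) :=
    Finset.sum_comm
  simp only [hcol, hrow, Finset.sum_const, Finset.card_univ, ZMod.card,
    ← Nat.cast_smul_eq_nsmul ℂ] at h2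
  exact smul_right_injective A (by norm_num : ((2 : ℕ) : ℂ) ≠ 0) h2

theorem row_block (hM : IsDoublePentagonMagic M) (i : ZMod 2) (a b : ZMod 5) :
    ∑ k, M (i, a) (k, b) = block M a b :=
  (hM.sum_col_eq_sum_row i 0 a b).symm.trans (hM.sum_col_eq_sum_row 0 0 a b)

theorem col_block (hM : IsDoublePentagonMagic M) (j : ZMod 2) (a b : ZMod 5) :
    ∑ k, M (k, a) (j, b) = block M a b :=
  hM.sum_col_eq_sum_row 0 j a b

theorem isPentagonMagic_block (hM : IsDoublePentagonMagic M) : IsPentagonMagic (block M) where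
  isStarProjection a b := by
    constructor
    · change block M a b * block M a b = block M a b
      simp [block, Finset.sum_mul_sum, hM.row_mul]
    · change star (block M a b) = block M a b
      simp [block, hM.star_eq]
  row_orthogonal a b c h := by
    simp [block, Finset.sum_mul_sum, hM.row_mul, h]
  col_orthogonal a b c h := by
    simp [← hM.col_block 0, Finset.sum_mul_sum, hM.col_mul, h]
  row_sum a := by
    rw [← hM.row_sum (0, a), Fintype.sum_prod_type_right]
    rfl
  col_sum a := by
    simp only [← hM.col_block 0]
    rw [← hM.col_sum (0, a), Fintype.sum_prod_type_right]
  adj a b := by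
    simpa only [hM.row_block, hM.col_block] using hM.adj 0 a 0 b

/-- With the block entry written as a sum over row `(i, a)`, both factors are partial sums of the
same row of `M`; orthogonality leaves their only common term. -/
theorem fibre_mul_block (hM : IsDoublePentagonMagic M) (i j : ZMod 2) (a b : ZMod 5) :
    fibre M a i j * block M a b = M (i, a) (j, b) := by
  rw [← hM.row_block i]
  simp [fibre, Finset.sum_mul_sum, hM.row_mul, ite_and]

theorem block_mul_fibre (hM : IsDoublePentagonMagic M) (i j : ZMod 2) (a b : ZMod 5) :
    block M a b * fibre M a i j = M (i, a) (j, b) := by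
  rw [← hM.row_block i]
  simp [fibre, Finset.sum_mul_sum, hM.row_mul, ite_and]

theorem isMagicUnitary_fibre (hM : IsDoublePentagonMagic M) (a : ZMod 5) :
    IsMagicUnitary (fibre M a) := by
  have hproj : ∀ i j, IsStarProjection (fibre M a i j) := fun i j => by
    constructor
    · change fibre M a i j * fibre M a i j = fibre M a i j
      simp [fibre, Finset.sum_mul_sum, hM.row_mul]
    · change star (fibre M a i j) = fibre M a i j
      simp [fibre, hM.star_eq]
  have hcol : ∀ j, ∑ i, fibre M a i j = 1 := fun j => by
    simp only [fibre, Matrix.of_apply]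
    rw [Finset.sum_comm, ← hM.isPentagonMagic_block.row_sum a]
    exact Finset.sum_congr rfl fun b _ => hM.col_block j a b
  refine ⟨hproj, fun i j k h => ?_, fun i j k h => ?_, fun i => ?_, hcol⟩
  · simp [fibre, Finset.sum_mul_sum, hM.row_mul, h]
  -- With only two entries in a column, one is the complement of the other.
  · have huniv : (Finset.univ : Finset (ZMod 2)) = {j, k} := by
      clear * - h; decide +revert
    have hsum := hcol i
    rw [huniv, Finset.sum_pair h] at hsum
    rw [eq_sub_of_add_eq' hsum]
    exact (hproj j i).mul_one_sub_self
  · rw [← hM.row_sum (i, a), Fintype.sum_prod_type]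
    rfl

end IsDoublePentagonMagic

/-! ## The isomorphism -/

/-- The free wreath product `C(ℤ/2) *_w C(D₅)`. -/
abbrev PentagonWreath : Type :=
  FreeWreathProduct (permutationMagic (cyclicPerm 2)) (permutationMagic (dihedralPerm 5))

namespace PentagonWreath

/-- The magic unitary of `C(ℤ/2) *_w C(D₅)`. -/
abbrev magic : Matrix (ZMod 2 × ZMod 5) (ZMod 2 × ZMod 5) PentagonWreath :=
  FreeWreathProduct.magic (permutationMagic (cyclicPerm 2)) (permutationMagic (dihedralPerm 5))

theorem isDoublePentagonMagic_magic : IsDoublePentagonMagic magic where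
  toIsMagicUnitary := FreeWreathProduct.isMagicUnitary_magic (isMagicUnitary_permutationMagic _)
    (isMagicUnitary_permutationMagic _)
  adj i a j b := by
    have hu (a : ZMod 5) := (isMagicUnitary_permutationMagic (cyclicPerm 2)).map
      (FreeWreathProduct.copy (permutationMagic (cyclicPerm 2))
        (permutationMagic (dihedralPerm 5)) a)
    have hcol (a : ZMod 5) := (hu a).col_sum j
    have hrow := (hu a).row_sum i
    have hv := (isPentagonMagic_permutationMagic.map
      (FreeWreathProduct.base (permutationMagic (cyclicPerm 2))
        (permutationMagic (dihedralPerm 5)))).adj a b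
    simp only [Matrix.map_apply] at hcol hrow hv
    -- Summing over `k` turns the entries of `u` into `1`, which leaves the pentagon relation for
    -- `v`.
    simp only [magic, FreeWreathProduct.magic, Matrix.of_apply, ← Finset.sum_mul, hcol, hrow,
      one_mul, hv]

variable {A : Type*} [CStarAlgebra A] {M : Matrix (ZMod 2 × ZMod 5) (ZMod 2 × ZMod 5) A}

/-- The `*`-homomorphism on `C(ℤ/2) *_w C(D₅)` defined by a magic unitary of the pentagon with
doubled vertices. -/
def lift (hM : IsDoublePentagonMagic M) : PentagonWreath →⋆ₐ[ℂ] A :=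
  FreeWreathProduct.lift (fun a => (hM.isMagicUnitary_fibre a).homTwo)
    hM.isPentagonMagic_block.hom fun a b i j => by
      rw [IsMagicUnitary.homTwo_permutationMagic, IsPentagonMagic.hom_permutationMagic,
        commute_iff_eq, hM.fibre_mul_block, hM.block_mul_fibre]

theorem lift_copy (hM : IsDoublePentagonMagic M) (a : ZMod 5) (i j : ZMod 2) :
    lift hM (FreeWreathProduct.copy _ _ a (permutationMagic (cyclicPerm 2) i j)) =
      ∑ b, M (i, a) (j, b) := by
  rw [lift, FreeWreathProduct.lift_copy, IsMagicUnitary.homTwo_permutationMagic]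
  rfl

theorem lift_base (hM : IsDoublePentagonMagic M) (a b : ZMod 5) :
    lift hM (FreeWreathProduct.base _ _ (permutationMagic (dihedralPerm 5) a b)) =
      ∑ k, M (0, a) (k, b) := by
  rw [lift, FreeWreathProduct.lift_base, IsPentagonMagic.hom_permutationMagic]
  rfl

theorem lift_magic (hM : IsDoublePentagonMagic M) (p q : ZMod 2 × ZMod 5) :
    lift hM (magic p q) = M p q := by
  rw [magic, FreeWreathProduct.magic, Matrix.of_apply, map_mul, lift_copy, lift_base]
  exact hM.fibre_mul_block p.1 q.1 p.2 q.2

/-- Sums of entries of `w` recover both `u` and `v`: summing over `b` removes `v`, and summing over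
`k` removes `u`. The entries of `u` and `v` in turn determine homomorphisms on `C(ℤ/2)` and `C(D₅)`.
-/
theorem starAlgHom_ext {f g : PentagonWreath →⋆ₐ[ℂ] A}
    (h : ∀ p q, f (magic p q) = g (magic p q)) : f = g := by
  have hu (a : ZMod 5) (i j : ZMod 2) :
      FreeWreathProduct.copy _ _ a (permutationMagic (cyclicPerm 2) i j) =
        ∑ b, magic (i, a) (j, b) := by
    simp only [magic, FreeWreathProduct.magic, Matrix.of_apply, ← Finset.mul_sum, ← map_sum]
    rw [(isMagicUnitary_permutationMagic (dihedralPerm 5)).row_sum, map_one, mul_one]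
  have hv (a b : ZMod 5) :
      FreeWreathProduct.base _ _ (permutationMagic (dihedralPerm 5) a b) =
        ∑ k, magic (0, a) (k, b) := by
    simp only [magic, FreeWreathProduct.magic, Matrix.of_apply, ← Finset.sum_mul, ← map_sum]
    rw [(isMagicUnitary_permutationMagic (cyclicPerm 2)).row_sum, map_one, one_mul]
  refine FreeWreathProduct.starAlgHom_ext (fun a => cyclicTwo_starAlgHom_ext fun i j => ?_)
    (dihedralGroup_starAlgHom_ext fun a b => ?_)
  · simp only [StarAlgHom.comp_apply, hu, map_sum, h]
  · simp only [StarAlgHom.comp_apply, hv, map_sum, h]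

theorem isDoublePentagonMagic_quantumAutomorphismAlgebra : IsDoublePentagonMagic
    ((QuantumAutomorphismAlgebra.magic (cycleWithChords 10 {4})).submatrix
      zmodTenEquiv zmodTenEquiv) where
  toIsMagicUnitary := (QuantumAutomorphismAlgebra.isMagicUnitary_magic _).submatrix _
  adj := adjCommute_cycleWithChords_iff.1 (QuantumAutomorphismAlgebra.adjCommute_magic _)

/-- The canonical map `A(C₁₀(4)) → C(ℤ/2) *_w C(D₅)`. -/
def ofQuantumAutomorphismAlgebra :
    QuantumAutomorphismAlgebra (cycleWithChords 10 {4}) →⋆ₐ[ℂ] PentagonWreath :=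
  QuantumAutomorphismAlgebra.lift (magic.submatrix zmodTenEquiv.symm zmodTenEquiv.symm)
    (isDoublePentagonMagic_magic.toIsMagicUnitary.submatrix _)
    (adjCommute_cycleWithChords_iff.2 (by
      simpa only [Matrix.submatrix_apply, Equiv.symm_apply_apply] using
        isDoublePentagonMagic_magic.adj))

theorem ofQuantumAutomorphismAlgebra_magic (p q : ZMod 2 × ZMod 5) :
    ofQuantumAutomorphismAlgebra (QuantumAutomorphismAlgebra.magic _ (zmodTenEquiv p)
      (zmodTenEquiv q)) = magic p q := by
  rw [ofQuantumAutomorphismAlgebra, QuantumAutomorphismAlgebra.lift_magic]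
  simp

/-- The isomorphism `A(C₁₀(4)) ≅ C(ℤ/2) *_w C(D₅)`. -/
def equiv : QuantumAutomorphismAlgebra (cycleWithChords 10 {4}) ≃⋆ₐ[ℂ] PentagonWreath :=
  StarAlgEquiv.ofStarAlgHom ofQuantumAutomorphismAlgebra
    (lift isDoublePentagonMagic_quantumAutomorphismAlgebra)
    (QuantumAutomorphismAlgebra.starAlgHom_ext _ fun x y => by
      obtain ⟨p, rfl⟩ := zmodTenEquiv.surjective x
      obtain ⟨q, rfl⟩ := zmodTenEquiv.surjective y
      rw [StarAlgHom.comp_apply, ofQuantumAutomorphismAlgebra_magic, lift_magic]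
      rfl)
    (starAlgHom_ext fun p q => by
      rw [StarAlgHom.comp_apply, lift_magic, Matrix.submatrix_apply,
        ofQuantumAutomorphismAlgebra_magic]
      rfl)

theorem equiv_magic (p q : ZMod 2 × ZMod 5) :
    equiv (QuantumAutomorphismAlgebra.magic _ (zmodTenEquiv p) (zmodTenEquiv q)) = magic p q :=
  ofQuantumAutomorphismAlgebra_magic p q

end PentagonWreath

/-! ## Transport of Hopf structures -/

/-- A `*`-homomorphism, between the opposite algebras. -/
def StarAlgHom.mop {A B : Type*} [CStarAlgebra A] [CStarAlgebra B] (f : A →⋆ₐ[ℂ] B) :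
    Aᵐᵒᵖ →⋆ₐ[ℂ] Bᵐᵒᵖ :=
  { AlgHom.op f.toAlgHom with
    map_star' := fun a => congrArg MulOpposite.op (map_star f a.unop) }

theorem StarAlgHom.mop_apply {A B : Type*} [CStarAlgebra A] [CStarAlgebra B] (f : A →⋆ₐ[ℂ] B)
    (a : Aᵐᵒᵖ) : f.mop a = MulOpposite.op (f a.unop) := rfl

namespace HopfCStarStructure

variable {A B ι κ : Type*} [CStarAlgebra A] [CStarAlgebra B] [Fintype ι] [DecidableEq ι]
  [Fintype κ] {u : Matrix ι ι A} {w : Matrix κ κ B}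
  {H : HopfCStarStructure A} {K : HopfCStarStructure B}

theorem IsMultiplicativeMagic.map_comul (hH : H.IsMultiplicativeMagic u) (Φ : A →⋆ₐ[ℂ] B)
    (e : κ ≃ ι) (h : ∀ p q, Φ (u (e p) (e q)) = w p q) (p q : κ) :
    MaxTensorProduct.map Φ Φ (H.comul (u (e p) (e q))) =
      ∑ k, MaxTensorProduct.tmul (w p k) (w k q) := by
  rw [hH.comul, map_sum, ← e.sum_comp]
  refine Finset.sum_congr rfl fun k _ => ?_
  simp only [MaxTensorProduct.tmul, map_mul, MaxTensorProduct.map_inl, MaxTensorProduct.map_inr, h]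

variable [DecidableEq κ]

/-- Conjugating `Δ`, `ε`, `S` by `Φ` gives maps with the required formulas on `w`, so the axioms
need not be transported one by one. -/
theorem IsMultiplicativeMagic.exists_of_starAlgEquiv (hgen : w.Generates)
    (hH : H.IsMultiplicativeMagic u) (Φ : A ≃⋆ₐ[ℂ] B) (e : κ ≃ ι)
    (h : ∀ p q, Φ (u (e p) (e q)) = w p q) :
    ∃ K : HopfCStarStructure B, K.IsMultiplicativeMagic w := by
  have hw : w = (u.submatrix e e).map (Φ : A →⋆ₐ[ℂ] B) := by
    ext p q; exact (h p q).symm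
  have hsymm : ∀ p q, (Φ.symm : B →⋆ₐ[ℂ] A) (w p q) = u (e p) (e q) := fun p q => by
    rw [← h]; exact Φ.symm_apply_apply _
  refine exists_isMultiplicativeMagic hgen (hw ▸ (hH.isMagicUnitary.submatrix e).map _)
    ((MaxTensorProduct.map (Φ : A →⋆ₐ[ℂ] B) (Φ : A →⋆ₐ[ℂ] B)).comp
      (H.comul.comp (Φ.symm : B →⋆ₐ[ℂ] A)))
    (H.counit.comp (Φ.symm : B →⋆ₐ[ℂ] A))
    ((Φ : A →⋆ₐ[ℂ] B).mop.comp (H.antipode.comp (Φ.symm : B →⋆ₐ[ℂ] A)))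
    (fun p q => ?_) (fun p q => ?_) (fun p q => ?_)
  · rw [StarAlgHom.comp_apply, StarAlgHom.comp_apply, hsymm, hH.map_comul _ e h]
  · rw [StarAlgHom.comp_apply, hsymm, hH.counit]
    simp
  · rw [StarAlgHom.comp_apply, StarAlgHom.comp_apply, hsymm, hH.antipode, StarAlgHom.mop_apply]
    exact congrArg MulOpposite.op (h q p)

/-- Both sides of each compatibility are homomorphisms on `A`, so it suffices to compare them on
`u`, where both structures have the same formulas. -/
theorem IsMultiplicativeMagic.isIso (hgen : u.Generates) (hH : H.IsMultiplicativeMagic u)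
    (hK : K.IsMultiplicativeMagic w) (Φ : A ≃⋆ₐ[ℂ] B) (e : κ ≃ ι)
    (h : ∀ p q, Φ (u (e p) (e q)) = w p q) : H.IsIso K Φ := by
  have h' : ∀ p q, (Φ : A →⋆ₐ[ℂ] B) (u (e p) (e q)) = w p q := h
  have hext {C : Type _} [CStarAlgebra C] {f g : A →⋆ₐ[ℂ] C}
      (hfg : ∀ p q, f (u (e p) (e q)) = g (u (e p) (e q))) : f = g :=
    hgen.starAlgHom_ext fun i j => by simpa using hfg (e.symm i) (e.symm j)
  have hcomul : K.comul.comp (Φ : A →⋆ₐ[ℂ] B) =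
      (MaxTensorProduct.map (Φ : A →⋆ₐ[ℂ] B) (Φ : A →⋆ₐ[ℂ] B)).comp H.comul :=
    hext fun p q => by
      rw [StarAlgHom.comp_apply, StarAlgHom.comp_apply, h', hK.comul, hH.map_comul _ e h']
  have hcounit : K.counit.comp (Φ : A →⋆ₐ[ℂ] B) = H.counit :=
    hgen.starAlgHom_ext fun i j => by
      obtain ⟨p, rfl⟩ := e.surjective i
      obtain ⟨q, rfl⟩ := e.surjective j
      rw [StarAlgHom.comp_apply, h', hK.counit, hH.counit]
      simp
  have hantipode : K.antipode.comp (Φ : A →⋆ₐ[ℂ] B) = (Φ : A →⋆ₐ[ℂ] B).mop.comp H.antipode :=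
    hext fun p q => by
      rw [StarAlgHom.comp_apply, StarAlgHom.comp_apply, h', hK.antipode, hH.antipode,
        StarAlgHom.mop_apply]
      exact congrArg MulOpposite.op (h q p).symm
  exact ⟨DFunLike.congr_fun hcomul, DFunLike.congr_fun hcounit, DFunLike.congr_fun hantipode⟩

end HopfCStarStructure

end

/-! ### The Hopf structures and their isomorphism -/

theorem corollary6p1 :
    (∃! H : HopfCStarStructure (QuantumAutomorphismAlgebra (cycleWithChords 10 {4})),
      H.IsMultiplicativeMagic (QuantumAutomorphismAlgebra.magic (cycleWithChords 10 {4}))) ∧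
    (∃! K : HopfCStarStructure
        (FreeWreathProduct (permutationMagic (cyclicPerm 2)) (permutationMagic (dihedralPerm 5))),
      K.IsMultiplicativeMagic
        (FreeWreathProduct.magic (permutationMagic (cyclicPerm 2))
          (permutationMagic (dihedralPerm 5)))) ∧
    ∃ (Φ : QuantumAutomorphismAlgebra (cycleWithChords 10 {4}) ≃⋆ₐ[ℂ]
        FreeWreathProduct (permutationMagic (cyclicPerm 2)) (permutationMagic (dihedralPerm 5)))
      (e : ZMod 2 × ZMod 5 ≃ ZMod 10),
      (∀ p q, Φ (QuantumAutomorphismAlgebra.magic (cycleWithChords 10 {4}) (e p) (e q)) =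
        FreeWreathProduct.magic (permutationMagic (cyclicPerm 2))
          (permutationMagic (dihedralPerm 5)) p q) ∧
      ∀ (H : HopfCStarStructure (QuantumAutomorphismAlgebra (cycleWithChords 10 {4})))
        (K : HopfCStarStructure
          (FreeWreathProduct (permutationMagic (cyclicPerm 2))
            (permutationMagic (dihedralPerm 5)))),
        H.IsMultiplicativeMagic (QuantumAutomorphismAlgebra.magic (cycleWithChords 10 {4})) →
        K.IsMultiplicativeMagic
          (FreeWreathProduct.magic (permutationMagic (cyclicPerm 2))
            (permutationMagic (dihedralPerm 5))) →
        H.IsIso K Φ := by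
  have hgenA := QuantumAutomorphismAlgebra.generates_magic (cycleWithChords 10 {4})
  have hgenB : PentagonWreath.magic.Generates :=
    hgenA.map (f := (PentagonWreath.equiv : _ →⋆ₐ[ℂ] PentagonWreath))
      PentagonWreath.equiv.surjective zmodTenEquiv PentagonWreath.equiv_magic
  obtain ⟨H, hH⟩ := HopfCStarStructure.exists_isMultiplicativeMagic hgenA
    (QuantumAutomorphismAlgebra.isMagicUnitary_magic _) _ _ _
    (QuantumAutomorphismAlgebra.comul_magic _) (QuantumAutomorphismAlgebra.counit_magic _)
    (QuantumAutomorphismAlgebra.antipode_magic _)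
  obtain ⟨K, hK⟩ := hH.exists_of_starAlgEquiv hgenB PentagonWreath.equiv zmodTenEquiv
    PentagonWreath.equiv_magic
  exact ⟨⟨H, hH, fun H' hH' => hH'.eq hgenA hH⟩, ⟨K, hK, fun K' hK' => hK'.eq hgenB hK⟩,
    PentagonWreath.equiv, zmodTenEquiv, PentagonWreath.equiv_magic, fun H K hH hK =>
      hH.isIso hgenA hK PentagonWreath.equiv zmodTenEquiv PentagonWreath.equiv_magic⟩
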